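/- Let $n\ge 1$ and let $\mathcal A$ be the space of real skew-symmetric $n\times n$ matrices, identified with Euclidean space $\mathbb R^{\binom n2}$ via $A\mapsto (A_{ij})_{i<j}$. Let $\mathcal{ST}\subset\mathcal A$ be the subspace of matrices with $A_{ik}=A_{ij}+A_{jk}$ for all $i,j,k$, equivalently $A=D(w):=(w_i-w_j)_{i,j}$ for some score vector $w\in\mathbb R^n$. Let $P$ be the orthogonal projection onto $\mathcal{ST}$ and $P_\perp$ the orthogonal projection onto $\mathcal{ST}^\perp$. For $A\in\mathcal A$ let $h(A)\in\mathbb R^n$ be the score vector of $P(A)$ with coordinate sum $0$. A cycle $\pi:i_1\to\dots\to i_k\to i_1$ has distinct vertices, $1\le k\le n$, and is considered up to the choice of its starting vertex; its value on $A$ is $f_A(\pi)=A_{i_1i_2}+\dots+A_{i_ki_1}$. Put $\lambda_{\max}(A)=\max_\pi f_A(\pi)/k$, the maximum over all cycles ($k$ being the length of $\pi$), and call the cycles attaining it critical. Let $\Pi_{n-1}\subset\mathbb R^n$ be the permutahedron, i.e. the convex hull of all permutations of $(1,\dots,n)$, with centre $e=(\tfrac{n+1}2,\dots,\tfrac{n+1}2)$.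 Fix $A\in\mathcal A$. 1. For every $r>0$ the projection onto $\mathcal{ST}$ of the cube $A+[-r,r]^{\binom n2}$ is $D\big(h(A)+\tfrac{2r}{n}(\Pi_{n-1}-e)\big)$. In particular (for $r=\tfrac12$) the projection of the cube of side $1$ centered at $A$ is the permutahedron scaled by $1/n$ and centered at $h(A)$. 2. Let $Z_\perp=P_\perp\big(A+[-1,1]^{\binom n2}\big)$ be the projection onto $\mathcal{ST}^\perp$ of the standard cube centered at $A$. It is a convex polytope, and a zonotope with centre $A-P(A)$, about which it is centrally symmetric. 3. $\lambda_{\max}(A)$ is the unique tropical (max-plus) eigenvalue of $A$, i.e. the unique $\mu\in\mathbb R$ such that some $m\in\mathbb R^n$ satisfies $\max_j(A_{ij}+m_j)=\mu+m_i$ for all $i$. In the norm on $\mathcal{ST}^\perp$ whose unit ball is $Z_\perp-(A-P(A))$, the distance from the centre $A-P(A)$ of $Z_\perp$ to $0$ equals $\lambda_{\max}(A)$. 4. Suppose $A\notin\mathcal{ST}$, and let $Q=\lambda_{\max}(A)\cdot Z_\perp$ denote the dilate of $Z_\perp$ about its centre $A-P(A)$ by the factor $\lambda_{\max}(A)$.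 Then the map sending a cycle $\pi$ to the face $\{x\in Q: f_x(\pi)=\min_{y\in Q}f_y(\pi)\}$ of $Q$ restricts to a bijection from the set of critical cycles of $A$ onto the set of facets of $Q$ that contain $0$. -/

import Mathlib

namespace PairwiseRanking

/-- The unordered pairs of items, listed as `(i, j)` with `i < j`. -/
abbrev Edge (n : ℕ) : Type := {p : Fin n × Fin n // p.1 < p.2}

/-- The space of additive paired comparison matrices, viewed as the Euclidean space
of dimension `n choose 2` by recording the entries above the diagonal. -/
abbrev APCMSpace (n : ℕ) : Type := EuclideanSpace ℝ (Edge n)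

/-- The vector `(A i j : i < j)` of a matrix `A`. -/
def vec {n : ℕ} (A : Matrix (Fin n) (Fin n) ℝ) : APCMSpace n :=
  WithLp.toLp 2 fun p => A p.1.1 p.1.2

/-- The skew-symmetric matrix with given entries above the diagonal. -/
def apcm {n : ℕ} : APCMSpace n →ₗ[ℝ] Matrix (Fin n) (Fin n) ℝ where
  toFun x := Matrix.of fun i j =>
    if h : i < j then x ⟨(i, j), h⟩ else if h : j < i then -x ⟨(j, i), h⟩ else 0
  map_add' x y := by
    ext i j
    simp only [Matrix.of_apply, Matrix.add_apply, PiLp.add_apply]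
    split_ifs <;> ring
  map_smul' c x := by
    ext i j
    simp only [Matrix.of_apply, Matrix.smul_apply, PiLp.smul_apply, smul_eq_mul, RingHom.id_apply]
    split_ifs <;> ring

theorem apcm_vec {n : ℕ} {A : Matrix (Fin n) (Fin n) ℝ} (hA : A.transpose = -A) :
    apcm (vec A) = A := by
  have hs : ∀ i j, A j i = -A i j := fun i j => by
    simpa using congrFun (congrFun hA i) j
  ext i j
  simp only [apcm, vec, LinearMap.coe_mk, AddHom.coe_mk, Matrix.of_apply]
  split_ifs with h1 h2
  · rfl
  · rw [hs i j, neg_neg]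
  · have hij : i = j := le_antisymm (not_lt.mp h2) (not_lt.mp h1)
    subst hij
    linarith [hs i i]

theorem vec_apcm {n : ℕ} (x : APCMSpace n) : vec (apcm x) = x := by
  ext p
  simp [apcm, vec, p.2]

/-- Strong transitivity. -/
def IsStronglyTransitive {n : ℕ} (M : Matrix (Fin n) (Fin n) ℝ) : Prop :=
  ∀ i j k, M i k = M i j + M j k

/-- The subspace of strongly transitive comparison matrices. -/
def ST (n : ℕ) : Submodule ℝ (APCMSpace n) where
  carrier := {x | IsStronglyTransitive (apcm x)}
  add_mem' {x y} hx hy i j k := by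
    rw [map_add, Matrix.add_apply, Matrix.add_apply, Matrix.add_apply, hx i j k, hy i j k]
    ring
  zero_mem' i j k := by simp
  smul_mem' c x hx i j k := by
    rw [map_smul, Matrix.smul_apply, Matrix.smul_apply, Matrix.smul_apply, hx i j k, smul_add]

/-- The comparison matrix `(w i - w j)` induced by a score vector `w`. -/
def scoreMatrix {n : ℕ} (w : Fin n → ℝ) : Matrix (Fin n) (Fin n) ℝ :=
  Matrix.of fun i j => w i - w j

/-- The score vector of a strongly transitive matrix, normalized to have coordinate sum `0`
(see `scoreMatrix_scoreVector`). -/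
noncomputable def scoreVector {n : ℕ} (M : Matrix (Fin n) (Fin n) ℝ) : Fin n → ℝ :=
  fun i => (1 / (n : ℝ)) * ∑ j, M i j

theorem scoreMatrix_scoreVector {n : ℕ} {M : Matrix (Fin n) (Fin n) ℝ}
    (hM : IsStronglyTransitive M) : scoreMatrix (scoreVector M) = M := by
  ext i j
  have hn : (n : ℝ) ≠ 0 := by
    have : 0 < n := i.pos
    positivity
  simp only [scoreMatrix, scoreVector, Matrix.of_apply]
  rw [← mul_sub, ← Finset.sum_sub_distrib]
  have : ∀ k ∈ Finset.univ, M i k - M j k = M i j := fun k _ => by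
    rw [hM i j k]; ring
  rw [Finset.sum_congr rfl this]
  simp [hn]

/-- The HodgeRank vector: the score vector of the orthogonal projection of `A` onto `ST`. -/
noncomputable def hodgeRank {n : ℕ} (A : Matrix (Fin n) (Fin n) ℝ) : Fin n → ℝ :=
  scoreVector (apcm ((ST n).starProjection (vec A)))

/-- The axis-parallel cube with centre `a` and half side `r`. -/
def cube {n : ℕ} (a : APCMSpace n) (r : ℝ) : Set (APCMSpace n) :=
  {x | ∀ p, |x p - a p| ≤ r}

/-- The `(n-1)`-permutahedron: the convex hull of the permutations of `(1, …, n)`. -/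
def permutahedron (n : ℕ) : Set (Fin n → ℝ) :=
  convexHull ℝ (Set.range fun σ : Equiv.Perm (Fin n) => fun i => ((σ i : ℕ) : ℝ) + 1)

/-- The barycentre `((n+1)/2, …, (n+1)/2)` of the permutahedron. -/
noncomputable def permutahedronCenter (n : ℕ) : Fin n → ℝ :=
  fun _ => ((n : ℝ) + 1) / 2

/-- The copy of the permutahedron scaled by `s` and centered at `h`. -/
noncomputable def scaledPermutahedron {n : ℕ} (s : ℝ) (h : Fin n → ℝ) : Set (Fin n → ℝ) :=
  (fun v => h + s • (v - permutahedronCenter n)) '' permutahedron n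

/-- The residual `A - P(A)`. -/
noncomputable def residual {n : ℕ} (A : Matrix (Fin n) (Fin n) ℝ) : APCMSpace n :=
  vec A - (ST n).starProjection (vec A)

/-- The projection onto the orthogonal complement of `ST` of the cube `A + [-1, 1] ^ (n choose 2)`. -/
noncomputable def Zperp {n : ℕ} (A : Matrix (Fin n) (Fin n) ℝ) : Set (APCMSpace n) :=
  (ST n)ᗮ.starProjection '' cube (vec A) 1

/-- An elementary directed cycle in the complete digraph (with loops) on `n` vertices:
a nonempty set of vertices together with a successor map that permutes it cyclically.
For uniqueness of the representation the successor map is the identity elsewhere.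
Thus cycles are considered up to the choice of the starting vertex; a loop has length `1`. -/
@[ext]
structure DirectedCycle (n : ℕ) where
  verts : Finset (Fin n)
  next : Equiv.Perm (Fin n)
  nonempty : verts.Nonempty
  isCycleOn : next.IsCycleOn (verts : Set (Fin n))
  next_of_notMem : ∀ i, i ∉ verts → next i = i

namespace DirectedCycle

/-- The number of edges of a cycle. -/
def length {n : ℕ} (π : DirectedCycle n) : ℕ := π.verts.card

/-- The value of a cycle: the sum of the weights of its edges. -/
def value {n : ℕ} (A : Matrix (Fin n) (Fin n) ℝ) (π : DirectedCycle n) : ℝ :=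
  ∑ i ∈ π.verts, A i (π.next i)

/-- The loop at a vertex. -/
def loop {n : ℕ} (i : Fin n) : DirectedCycle n where
  verts := {i}
  next := 1
  nonempty := Finset.singleton_nonempty i
  isCycleOn := by simp
  next_of_notMem _ _ := rfl

instance {n : ℕ} : Finite (DirectedCycle n) :=
  Finite.of_injective (fun π : DirectedCycle n => (π.verts, π.next)) fun π ρ h => by
    rw [Prod.mk.injEq] at h
    exact DirectedCycle.ext h.1 h.2

end DirectedCycle

/-- The maximal normalized cycle value. -/
noncomputable def lambdaMax {n : ℕ} (A : Matrix (Fin n) (Fin n) ℝ) : ℝ :=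
  ⨆ π : DirectedCycle n, π.value A / π.length

/-- The supremum is a maximum. -/
theorem isGreatest_lambdaMax {n : ℕ} (hn : 1 ≤ n) (A : Matrix (Fin n) (Fin n) ℝ) :
    IsGreatest (Set.range fun π : DirectedCycle n => π.value A / π.length) (lambdaMax A) := by
  have : Nonempty (DirectedCycle n) := ⟨DirectedCycle.loop ⟨0, hn⟩⟩
  have hfin := Set.finite_range fun π : DirectedCycle n => π.value A / (π.length : ℝ)
  exact ⟨(Set.range_nonempty _).csSup_mem hfin, fun x hx => le_csSup hfin.bddAbove hx⟩

/-- A cycle is critical if its normalized value is maximal. -/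
def IsCritical {n : ℕ} (A : Matrix (Fin n) (Fin n) ℝ) (π : DirectedCycle n) : Prop :=
  π.value A / π.length = lambdaMax A

/-- `A ⊙ m = μ ⊙ m` in the max-plus algebra: `max_j (A i j + m j) = μ + m i` for all `i`. -/
def IsTropicalEigenpair {n : ℕ} (A : Matrix (Fin n) (Fin n) ℝ) (μ : ℝ) (m : Fin n → ℝ) : Prop :=
  ∀ i, IsGreatest (Set.range fun j => A i j + m j) (μ + m i)

/-- A polytope: the convex hull of a finite set. -/
def IsPolytope {n : ℕ} (P : Set (APCMSpace n)) : Prop :=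
  ∃ V : Finset (APCMSpace n), P = convexHull ℝ (V : Set (APCMSpace n))

/-- A zonotope with centre `c`: a Minkowski sum `c + ∑ k, [-v k, v k]` of segments. -/
def IsZonotope {n : ℕ} (c : APCMSpace n) (P : Set (APCMSpace n)) : Prop :=
  ∃ (m : ℕ) (v : Fin m → APCMSpace n),
    P = {x | ∃ t : Fin m → ℝ, (∀ k, |t k| ≤ 1) ∧ x = c + ∑ k, t k • v k}

/-- A facet of a polytope: a nonempty face of codimension one. -/
def IsFacet {n : ℕ} (P F : Set (APCMSpace n)) : Prop :=
  F.Nonempty ∧ IsExposed ℝ P F ∧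
    Module.finrank ℝ (vectorSpan ℝ F) + 1 = Module.finrank ℝ (vectorSpan ℝ P)

/-- The face of `P` on which the value of the cycle `π` is minimal. -/
def cycleFace {n : ℕ} (P : Set (APCMSpace n)) (π : DirectedCycle n) : Set (APCMSpace n) :=
  {x ∈ P | ∀ y ∈ P, π.value (apcm x) ≤ π.value (apcm y)}

end PairwiseRanking

/-!
The orthogonal complement of the strongly transitive matrices consists of the circulations, that is,
the skew-symmetric matrices with vanishing row sums (`mem_ST_orthogonal_iff`), and the orthogonal
projection onto the strongly transitive matrices takes row averages as scores
(`starProjection_ST`).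

*Projection of the cube onto the strongly transitive matrices.* A linear functional `c` of the row
averages is maximized over the cube by the signs of the differences `c i - c j`, hence by any
ranking that sorts `c`. The row sums of the sign matrix of a ranking recover the ranking, so no
hyperplane separates a point of the image of the cube from the permutahedron
(`scoreMap_image_cube`).

*Tropical eigenvalue.* Summing `A i j + w j ≤ t + w i` along a cycle bounds all cycle means by `t`,
with equality for a cycle of tight edges. At the least `t` for which such a `w` exists, a `w` with
fewest tight vertices has a set of vertices with tight edges into the set itself
(`exists_tight_set`), and this set can be grown to all vertices, which gives an eigenvector
(`exists_isTropicalEigenpair`). Following tight edges produces a cycle, so an eigenvalue is always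
the maximal cycle mean. The origin lies in the projection of the cube of half side `r` exactly when
some score matrix is within `r` of `A`, which by skew-symmetry is the inequality above with `t = r`
(`zero_mem_circProj_image_cube_iff`); this is the statement on the norm.

*Facets through the origin.* The dilate of the zonotope by `λ = lambdaMax A` is the projection of
the cube of half side `λ`. On it a critical cycle has value at least zero, and it vanishes exactly
when all the edges of the cycle are at their lower bounds. The remaining edges are free, and a
circulation supported on a cycle is constant along it (`DirectedCycle.eq_smul_circMatrix`), so the
face has codimension one (`vectorSpan_cycleFace`). The free edges also show that the face determines
the cycle (`injOn_cycleFace`). Conversely, a facet through the origin is exposed by a nonzero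
circulation. At a point of the cube that projects to the origin, its positive edges are at their
lower bounds, so any cycle of positive edges is critical. The face of that cycle contains the
facet and equals it by dimension (`exists_isCritical_cycleFace_eq`).
-/

namespace PairwiseRanking

variable {n : ℕ}

/-! ### Skew-symmetric matrices as Euclidean vectors -/

theorem apcm_apply_of_lt (x : APCMSpace n) {i j : Fin n} (h : i < j) :
    apcm x i j = x ⟨(i, j), h⟩ := by
  simp [apcm, h]

theorem apcm_swap (x : APCMSpace n) (i j : Fin n) : apcm x j i = -apcm x i j := by
  rcases lt_trichotomy i j with h | h | h
  · simp [apcm, h, h.not_gt]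
  · subst h; simp [apcm]
  · simp [apcm, h, h.not_gt]

theorem apcm_self (x : APCMSpace n) (i : Fin n) : apcm x i i = 0 := by
  simp [apcm]

theorem apcm_injective : Function.Injective (apcm : APCMSpace n → Matrix (Fin n) (Fin n) ℝ) :=
  Function.LeftInverse.injective vec_apcm

theorem apcm_vec_of_swap {M : Matrix (Fin n) (Fin n) ℝ} (hM : ∀ i j, M j i = -M i j) :
    apcm (vec M) = M :=
  apcm_vec (by ext i j; simp [hM i j])

theorem apcm_vec_scoreMatrix (w : Fin n → ℝ) :
    apcm (vec (scoreMatrix w)) = scoreMatrix w :=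
  apcm_vec_of_swap fun i j => by simp [scoreMatrix]

/-- Summing a symmetric function over all ordered pairs counts each edge twice. -/
theorem sum_sum_eq_two_mul_sum_edge (F : Fin n → Fin n → ℝ) (hs : ∀ i j, F j i = F i j)
    (h0 : ∀ i, F i i = 0) : ∑ i, ∑ j, F i j = 2 * ∑ p : Edge n, F p.1.1 p.1.2 := by
  have h1 : ∀ i j, F i j = (if i < j then F i j else 0) + (if j < i then F j i else 0) := by
    intro i j
    rcases lt_trichotomy i j with h | h | h
    · simp [h, h.not_gt]
    · subst h; simp [h0]
    · simp [h, h.not_gt, hs]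
  have h2 : ∑ i, ∑ j, (if i < j then F i j else 0) = ∑ p : Edge n, F p.1.1 p.1.2 := by
    rw [← Fintype.sum_prod_type' (f := fun i j : Fin n => if i < j then F i j else 0),
      ← Finset.sum_filter]
    exact Finset.sum_subtype _ (by simp) (fun p : Fin n × Fin n => F p.1 p.2)
  calc ∑ i, ∑ j, F i j
      = ∑ i, ∑ j, ((if i < j then F i j else 0) + (if j < i then F j i else 0)) :=
        Finset.sum_congr rfl fun i _ => Finset.sum_congr rfl fun j _ => h1 i j
    _ = ∑ i, ∑ j, (if i < j then F i j else 0) + ∑ i, ∑ j, (if j < i then F j i else 0) := by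
        simp only [Finset.sum_add_distrib]
    _ = _ := by rw [Finset.sum_comm (f := fun i j : Fin n => if j < i then F j i else 0), h2]; ring

theorem sum_sum_apcm_mul_apcm (x y : APCMSpace n) :
    ∑ i, ∑ j, apcm x i j * apcm y i j = 2 * inner ℝ x y := by
  rw [sum_sum_eq_two_mul_sum_edge]
  · congr 1
    rw [PiLp.inner_apply]
    refine Finset.sum_congr rfl fun p _ => ?_
    rw [apcm_apply_of_lt x p.2, apcm_apply_of_lt y p.2]
    simp [mul_comm]
  · intro i j; rw [apcm_swap x, apcm_swap y]; ring
  · intro i; simp [apcm_self]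

/-- Pairing with a score matrix is pairing of the scores with the row sums. -/
theorem sum_sum_mul_sub {D : Fin n → Fin n → ℝ} (hD : ∀ i j, D j i = -D i j) (w : Fin n → ℝ) :
    ∑ i, ∑ j, D i j * (w i - w j) = 2 * ∑ i, w i * ∑ j, D i j := by
  have h1 : ∑ i, ∑ j, D i j * w j = -∑ i, ∑ j, D i j * w i := by
    rw [Finset.sum_comm, ← Finset.sum_neg_distrib]
    refine Finset.sum_congr rfl fun i _ => ?_
    rw [← Finset.sum_neg_distrib]
    exact Finset.sum_congr rfl fun j _ => by rw [hD i j]; ring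
  have h2 : ∑ i, w i * ∑ j, D i j = ∑ i, ∑ j, D i j * w i :=
    Finset.sum_congr rfl fun i _ => by rw [Finset.mul_sum]; simp only [mul_comm]
  simp only [mul_sub, Finset.sum_sub_distrib]
  rw [h1, h2]; ring

theorem two_mul_inner_vec_scoreMatrix (x : APCMSpace n) (w : Fin n → ℝ) :
    2 * inner ℝ x (vec (scoreMatrix w)) = 2 * ∑ i, w i * ∑ j, apcm x i j := by
  rw [← sum_sum_apcm_mul_apcm, apcm_vec_scoreMatrix, ← sum_sum_mul_sub (apcm_swap x)]
  rfl

/-! ### Strongly transitive matrices and circulations -/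

theorem vec_scoreMatrix_mem_ST (w : Fin n → ℝ) : vec (scoreMatrix w) ∈ ST n := by
  intro i j k
  rw [apcm_vec_scoreMatrix]
  simp [scoreMatrix]

theorem mem_ST_iff {x : APCMSpace n} : x ∈ ST n ↔ ∃ w, apcm x = scoreMatrix w := by
  constructor
  · exact fun h => ⟨_, (scoreMatrix_scoreVector h).symm⟩
  · rintro ⟨w, hw⟩
    rw [← vec_apcm x, hw]
    exact vec_scoreMatrix_mem_ST w

/-- The orthogonal complement of the strongly transitive matrices consists of the circulations,
the matrices with vanishing row sums. -/
theorem mem_ST_orthogonal_iff {x : APCMSpace n} : x ∈ (ST n)ᗮ ↔ ∀ i, ∑ j, apcm x i j = 0 := by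
  rw [Submodule.mem_orthogonal']
  constructor
  · intro h i
    have h1 := two_mul_inner_vec_scoreMatrix x (Pi.single i 1)
    rw [h _ (vec_scoreMatrix_mem_ST _)] at h1
    simpa [Pi.single_apply] using h1
  · intro h u hu
    obtain ⟨w, hw⟩ := mem_ST_iff.1 hu
    have h1 := two_mul_inner_vec_scoreMatrix x w
    rw [← hw, vec_apcm] at h1
    simpa [h] using h1

theorem sum_sum_apcm (x : APCMSpace n) : ∑ i, ∑ j, apcm x i j = 0 := by
  have h := sum_sum_mul_sub (apcm_swap x) (fun _ => 1)
  simp only [sub_self, mul_zero, Finset.sum_const_zero, one_mul] at h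
  linarith

/-- The orthogonal projection onto the strongly transitive matrices takes row averages as
scores. -/
theorem starProjection_ST (x : APCMSpace n) :
    (ST n).starProjection x = vec (scoreMatrix (scoreVector (apcm x))) := by
  refine Submodule.eq_starProjection_of_mem_orthogonal (vec_scoreMatrix_mem_ST _) ?_
  rw [mem_ST_orthogonal_iff]
  intro i
  have hn : (n : ℝ) ≠ 0 := by
    have := i.pos
    positivity
  have h0 := sum_sum_apcm x
  rw [map_sub, apcm_vec_scoreMatrix]
  simp only [Matrix.sub_apply, scoreMatrix, scoreVector, Matrix.of_apply, Finset.sum_sub_distrib,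
    ← Finset.mul_sum, h0]
  simp [hn]

theorem scoreVector_scoreMatrix (w : Fin n → ℝ) (hw : ∑ i, w i = 0) :
    scoreVector (scoreMatrix w) = w := by
  ext i
  have hn : (n : ℝ) ≠ 0 := by
    have := i.pos
    positivity
  simp [scoreVector, scoreMatrix, hw, hn]

theorem sum_scoreVector_apcm (x : APCMSpace n) : ∑ i, scoreVector (apcm x) i = 0 := by
  simp only [scoreVector, ← Finset.mul_sum]
  rw [sum_sum_apcm, mul_zero]

theorem hodgeRank_eq {A : Matrix (Fin n) (Fin n) ℝ} (hA : A.transpose = -A) :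
    hodgeRank A = scoreVector A := by
  have h := sum_scoreVector_apcm (vec A)
  rw [hodgeRank, starProjection_ST, apcm_vec_scoreMatrix,
    scoreVector_scoreMatrix _ h, apcm_vec hA]

/-! ### Cubes -/

theorem mem_cube_iff {a x : APCMSpace n} {r : ℝ} (hr : 0 ≤ r) :
    x ∈ cube a r ↔ ∀ i j, |apcm x i j - apcm a i j| ≤ r := by
  constructor
  · intro h i j
    rcases lt_trichotomy i j with hij | hij | hij
    · rw [apcm_apply_of_lt x hij, apcm_apply_of_lt a hij]; exact h _
    · subst hij; simpa [apcm_self] using hr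
    · rw [apcm_swap x j i, apcm_swap a j i, apcm_apply_of_lt x hij, apcm_apply_of_lt a hij,
        neg_sub_neg, abs_sub_comm]
      exact h _
  · intro h p
    have := h p.1.1 p.1.2
    rwa [apcm_apply_of_lt x p.2, apcm_apply_of_lt a p.2] at this

theorem convex_cube (a : APCMSpace n) (r : ℝ) : Convex ℝ (cube a r) := by
  intro x hx y hy s t hs ht hst p
  have h1 := abs_le.1 (hx p)
  have h2 := abs_le.1 (hy p)
  have h3 : (s • x + t • y) p - a p = s * (x p - a p) + t * (y p - a p) := by
    simp only [PiLp.add_apply, PiLp.smul_apply, smul_eq_mul]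
    linear_combination a p * hst
  rw [h3, abs_le]
  constructor <;> nlinarith

/-! ### The projection of the cube onto the strongly transitive matrices -/

/-- The row sums of the sign matrix of a ranking recover the ranking, up to scale and shift. -/
theorem sum_sign_sub (σ : Equiv.Perm (Fin n)) (i : Fin n) :
    ∑ j, ((SignType.sign ((σ i : ℝ) - (σ j : ℝ)) : SignType) : ℝ) =
      2 * (σ i : ℝ) - ((n : ℝ) - 1) := by
  rw [Equiv.sum_comp σ fun k : Fin n =>
    ((SignType.sign (((σ i : ℕ) : ℝ) - ((k : ℕ) : ℝ)) : SignType) : ℝ)]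
  set a := σ i
  have h1 : ∀ k : Fin n, ((SignType.sign (((a : ℕ) : ℝ) - ((k : ℕ) : ℝ)) : SignType) : ℝ) =
      (if k < a then 1 else 0) - (if a < k then 1 else 0) := by
    intro k
    rcases lt_trichotomy k a with h | h | h
    · have : (0 : ℝ) < ((a : ℕ) : ℝ) - ((k : ℕ) : ℝ) := by
        rw [sub_pos]; exact_mod_cast h
      rw [sign_pos this]; simp [h, h.not_gt]
    · subst h; simp
    · have : ((a : ℕ) : ℝ) - ((k : ℕ) : ℝ) < 0 := by
        rw [sub_neg]; exact_mod_cast h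
      rw [sign_neg this]; simp [h, h.not_gt]
  simp only [h1, Finset.sum_sub_distrib, Finset.sum_boole]
  have h2 : (Finset.univ.filter fun k : Fin n => k < a) = Finset.Iio a := by ext; simp
  have h3 : (Finset.univ.filter fun k : Fin n => a < k) = Finset.Ioi a := by ext; simp
  rw [h2, h3, Fin.card_Iio, Fin.card_Ioi]
  have := a.isLt
  rw [Nat.sub_sub, Nat.cast_sub (by omega)]
  push_cast
  ring

theorem coe_sign_sub_swap (f : Fin n → ℝ) (i j : Fin n) :
    ((SignType.sign (f j - f i) : SignType) : ℝ) = -((SignType.sign (f i - f j) : SignType) : ℝ) := by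
  rw [← neg_sub, Left.sign_neg, SignType.coe_neg]

theorem abs_coe_sign_le_one (t : ℝ) : |((SignType.sign t : SignType) : ℝ)| ≤ 1 := by
  rcases lt_trichotomy t 0 with h | h | h <;> simp [h]

/-- The comparison matrix recording only the outcomes of the comparisons of a score vector. -/
noncomputable def signMatrix (f : Fin n → ℝ) : Matrix (Fin n) (Fin n) ℝ :=
  Matrix.of fun i j => ((SignType.sign (f i - f j) : SignType) : ℝ)

theorem signMatrix_swap (f : Fin n → ℝ) (i j : Fin n) : signMatrix f j i = -signMatrix f i j :=
  coe_sign_sub_swap f i j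

theorem scoreVector_add (M N : Matrix (Fin n) (Fin n) ℝ) :
    scoreVector (M + N) = scoreVector M + scoreVector N := by
  ext i
  simp [scoreVector, Finset.sum_add_distrib, mul_add]

theorem scoreVector_smul (c : ℝ) (M : Matrix (Fin n) (Fin n) ℝ) :
    scoreVector (c • M) = c • scoreVector M := by
  ext i
  simp only [scoreVector, Matrix.smul_apply, Pi.smul_apply, smul_eq_mul, ← Finset.mul_sum]
  ring

/-- Row averages of a skew-symmetric matrix, as a linear map. -/
noncomputable def scoreMap (n : ℕ) : APCMSpace n →ₗ[ℝ] (Fin n → ℝ) where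
  toFun x := scoreVector (apcm x)
  map_add' x y := by rw [map_add, scoreVector_add]
  map_smul' c x := by rw [map_smul, scoreVector_smul, RingHom.id_apply]

/-- A ranking, seen as a vertex of the cube, is sent to the corresponding vertex of the scaled
permutahedron. -/
theorem scoreVector_add_smul_signMatrix (A : Matrix (Fin n) (Fin n) ℝ) (r : ℝ)
    (σ : Equiv.Perm (Fin n)) :
    scoreVector (A + r • signMatrix fun i => ((σ i : ℕ) : ℝ)) =
      scoreVector A + (2 * r / n) •
        ((fun i => ((σ i : ℕ) : ℝ) + 1) - permutahedronCenter n) := by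
  rw [scoreVector_add, scoreVector_smul]
  congr 1
  ext i
  have h := sum_sign_sub σ i
  simp only [Pi.smul_apply, smul_eq_mul, scoreVector, signMatrix, Matrix.of_apply, h, Pi.sub_apply,
    permutahedronCenter]
  ring

theorem vec_add_smul_signMatrix_mem_cube {A : Matrix (Fin n) (Fin n) ℝ} {r : ℝ} (hr : 0 ≤ r)
    (f : Fin n → ℝ) : vec (A + r • signMatrix f) ∈ cube (vec A) r := by
  intro p
  have : vec (A + r • signMatrix f) p - vec A p = r * signMatrix f p.1.1 p.1.2 := by simp [vec]
  rw [this, abs_mul, abs_of_nonneg hr]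
  exact mul_le_of_le_one_right hr (abs_coe_sign_le_one _)

theorem skew_apply {A : Matrix (Fin n) (Fin n) ℝ} (hA : A.transpose = -A) (i j : Fin n) :
    A j i = -A i j := by
  simpa using congrFun (congrFun hA i) j

/-- A linear functional on scores, evaluated at row averages of a skew-symmetric matrix. -/
theorem two_mul_sum_mul_scoreVector {D : Matrix (Fin n) (Fin n) ℝ} (hD : ∀ i j, D j i = -D i j)
    (c : Fin n → ℝ) :
    2 * ∑ i, c i * scoreVector D i = (1 / (n : ℝ)) * ∑ i, ∑ j, D i j * (c i - c j) := by
  rw [sum_sum_mul_sub hD]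
  simp only [scoreVector, Finset.mul_sum]
  exact Finset.sum_congr rfl fun i _ => Finset.sum_congr rfl fun j _ => by ring

/-- Over the row averages of the cube, a linear functional is maximal at a ranking that sorts its
coefficients. -/
theorem sum_mul_scoreVector_le {D : Matrix (Fin n) (Fin n) ℝ} (hD : ∀ i j, D j i = -D i j)
    {r : ℝ} (hDr : ∀ i j, |D i j| ≤ r) (c f : Fin n → ℝ) (hf : Function.Injective f)
    (hc : ∀ i j, f i < f j → c i ≤ c j) :
    ∑ i, c i * scoreVector D i ≤ ∑ i, c i * scoreVector (r • signMatrix f) i := by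
  have hS : ∀ i j, (r • signMatrix f) j i = -(r • signMatrix f) i j := fun i j => by
    simp [signMatrix_swap f i j]
  have h : (1 / (n : ℝ)) * ∑ i, ∑ j, D i j * (c i - c j) ≤
      (1 / (n : ℝ)) * ∑ i, ∑ j, (r • signMatrix f) i j * (c i - c j) := by
    refine mul_le_mul_of_nonneg_left ?_ (by positivity)
    refine Finset.sum_le_sum fun i _ => Finset.sum_le_sum fun j _ => ?_
    have hD' := abs_le.1 (hDr i j)
    simp only [Matrix.smul_apply, signMatrix, Matrix.of_apply, smul_eq_mul]
    rcases lt_trichotomy (f i) (f j) with hij | hij | hij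
    · rw [sign_neg (sub_neg.2 hij)]
      have := hc i j hij
      simp only [SignType.coe_neg, SignType.coe_one]
      nlinarith
    · rw [hf hij]; simp
    · rw [sign_pos (sub_pos.2 hij)]
      have := hc j i hij
      simp only [SignType.coe_one]
      nlinarith
  linarith [two_mul_sum_mul_scoreVector hD c, two_mul_sum_mul_scoreVector hS c]

/-- The row averages over the cube form a permutahedron. -/
theorem scoreMap_image_cube {A : Matrix (Fin n) (Fin n) ℝ} (hA : A.transpose = -A) {r : ℝ}
    (hr : 0 ≤ r) :
    scoreMap n '' cube (vec A) r = scaledPermutahedron (2 * r / n) (scoreVector A) := by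
  have hvert : ∀ σ : Equiv.Perm (Fin n),
      scoreMap n (vec (A + r • signMatrix fun i => ((σ i : ℕ) : ℝ))) =
        scoreVector A + (2 * r / n) • ((fun i => ((σ i : ℕ) : ℝ) + 1) - permutahedronCenter n) := by
    intro σ
    rw [← scoreVector_add_smul_signMatrix]
    change scoreVector (apcm _) = _
    rw [apcm_vec_of_swap]
    intro i j
    simp only [Matrix.add_apply, Matrix.smul_apply, smul_eq_mul, skew_apply hA i j,
      signMatrix_swap _ i j]
    ring
  -- the affine map taking the permutahedron to its scaled copy
  let g : (Fin n → ℝ) →ᵃ[ℝ] (Fin n → ℝ) :=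
    AffineMap.const ℝ _ (scoreVector A) +
      (2 * r / n) • (AffineMap.id ℝ (Fin n → ℝ) - AffineMap.const ℝ _ (permutahedronCenter n))
  have hg : ∀ v, g v = scoreVector A + (2 * r / n) • (v - permutahedronCenter n) := fun v => rfl
  have himg : scaledPermutahedron (2 * r / n) (scoreVector A) =
      convexHull ℝ (Set.range fun σ : Equiv.Perm (Fin n) =>
        g fun i => ((σ i : ℕ) : ℝ) + 1) := by
    change g '' convexHull ℝ _ = _
    rw [AffineMap.image_convexHull g, ← Set.range_comp]
    rfl
  rw [himg]
  refine Set.Subset.antisymm ?_ (convexHull_min ?_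
    ((convex_cube (vec A) r).linear_image (scoreMap n)))
  · rintro _ ⟨x, hx, rfl⟩
    by_contra hnot
    have hfin := Set.finite_range fun σ : Equiv.Perm (Fin n) => g fun i => ((σ i : ℕ) : ℝ) + 1
    obtain ⟨l, u, hl, hu⟩ := geometric_hahn_banach_closed_point (convex_convexHull ℝ _)
      (hfin.isCompact_convexHull ℝ).isClosed hnot
    let c : Fin n → ℝ := fun i => l (Pi.single i 1)
    have hlc : ∀ v, l v = ∑ i, c i * v i := by
      intro v
      conv_lhs => rw [← Finset.univ_sum_single v]
      rw [map_sum]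
      refine Finset.sum_congr rfl fun i _ => ?_
      have : Pi.single i (v i) = v i • (Pi.single i 1 : Fin n → ℝ) := by
        rw [← Pi.single_smul]; simp
      rw [this, map_smul, smul_eq_mul, mul_comm]
    let σ : Equiv.Perm (Fin n) := (Tuple.sort c)⁻¹
    have hσ : ∀ i j, (((σ i : ℕ) : ℝ)) < ((σ j : ℕ) : ℝ) → c i ≤ c j := by
      intro i j hij
      have h1 : σ i ≤ σ j := by
        have : (σ i : ℕ) < σ j := by exact_mod_cast hij
        exact le_of_lt this
      have h2 := Tuple.monotone_sort c h1
      simpa [σ] using h2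
    have hinj : Function.Injective fun i => ((σ i : ℕ) : ℝ) := fun i j hij => by
      simpa [Fin.val_inj] using hij
    have hv : l (g fun i => ((σ i : ℕ) : ℝ) + 1) < u := hl _ (subset_convexHull ℝ _ ⟨σ, rfl⟩)
    rw [hg, ← scoreVector_add_smul_signMatrix, scoreVector_add, map_add, hlc (scoreVector (r • _))]
      at hv
    have hD : ∀ i j, (apcm x - A) j i = -(apcm x - A) i j := fun i j => by
      simp only [Matrix.sub_apply, apcm_swap x i j, skew_apply hA i j]; ring
    have hDr : ∀ i j, |(apcm x - A) i j| ≤ r := fun i j => by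
      have := (mem_cube_iff hr).1 hx i j
      rwa [apcm_vec hA] at this
    have hle := sum_mul_scoreVector_le hD hDr c _ hinj hσ
    have hx' : l (scoreMap n x) = l (scoreVector A) + ∑ i, c i * scoreVector (apcm x - A) i := by
      rw [← hlc, ← map_add, ← scoreVector_add, add_sub_cancel]
      rfl
    linarith
  · rintro _ ⟨σ, rfl⟩
    exact ⟨_, vec_add_smul_signMatrix_mem_cube hr _, (hvert σ).trans (hg _).symm⟩

theorem starProjection_ST_image_cube {A : Matrix (Fin n) (Fin n) ℝ} (hA : A.transpose = -A)
    {r : ℝ} (hr : 0 ≤ r) :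
    (ST n).starProjection '' cube (vec A) r =
      (fun w => vec (scoreMatrix w)) '' scaledPermutahedron (2 * r / n) (hodgeRank A) := by
  rw [hodgeRank_eq hA, ← scoreMap_image_cube hA hr, Set.image_image]
  exact Set.image_congr fun x _ => starProjection_ST x

/-! ### The projection of the cube onto the circulations -/

/-- The orthogonal projection onto the circulations, as a linear map. -/
noncomputable abbrev circProj (n : ℕ) : APCMSpace n →ₗ[ℝ] APCMSpace n :=
  ((ST n)ᗮ.starProjection : APCMSpace n →ₗ[ℝ] APCMSpace n)

theorem circProj_apply (x : APCMSpace n) : circProj n x = x - (ST n).starProjection x := by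
  simp [Submodule.starProjection_orthogonal]

theorem circProj_mem (x : APCMSpace n) : circProj n x ∈ (ST n)ᗮ :=
  Submodule.starProjection_apply_mem _ x

theorem circProj_eq_zero_iff {x : APCMSpace n} : circProj n x = 0 ↔ x ∈ ST n := by
  rw [circProj_apply, sub_eq_zero, eq_comm, Submodule.starProjection_eq_self_iff]

theorem inner_circProj_right {y : APCMSpace n} (hy : y ∈ (ST n)ᗮ) (x : APCMSpace n) :
    inner ℝ y (circProj n x) = inner ℝ y x := by
  rw [circProj_apply, inner_sub_right,
    (Submodule.mem_orthogonal' _ _).1 hy _ (Submodule.starProjection_apply_mem _ x), sub_zero]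

theorem residual_eq (A : Matrix (Fin n) (Fin n) ℝ) : residual A = circProj n (vec A) :=
  (circProj_apply _).symm

theorem Zperp_eq (A : Matrix (Fin n) (Fin n) ℝ) : Zperp A = circProj n '' cube (vec A) 1 := rfl

theorem isPolytope_Zperp (A : Matrix (Fin n) (Fin n) ℝ) : IsPolytope (Zperp A) := by
  let s : Edge n → Set ℝ := fun p => {vec A p - 1, vec A p + 1}
  have hs : (Set.univ.pi s).Finite := Set.Finite.pi fun p => Set.toFinite _
  let e : (Edge n → ℝ) →ₗ[ℝ] APCMSpace n :=
    (WithLp.linearEquiv 2 ℝ (Edge n → ℝ)).symm.toLinearMap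
  have hcube : cube (vec A) 1 = e '' convexHull ℝ (Set.univ.pi s) := by
    rw [convexHull_pi]
    ext x
    simp only [s, convexHull_pair]
    constructor
    · intro hx
      refine ⟨WithLp.ofLp x, fun p _ => ?_, rfl⟩
      have := abs_le.1 (hx p)
      change x p ∈ segment ℝ (vec A p - 1) (vec A p + 1)
      rw [segment_eq_Icc (by linarith)]
      constructor <;> linarith
    · rintro ⟨y, hy, rfl⟩ p
      have h : y p ∈ segment ℝ (vec A p - 1) (vec A p + 1) := hy p trivial
      rw [segment_eq_Icc (by linarith)] at h
      change |y p - vec A p| ≤ 1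
      rw [abs_le]
      constructor <;> linarith [h.1, h.2]
  refine ⟨(((hs.image e).image (circProj n))).toFinset, ?_⟩
  rw [Zperp_eq, hcube, Set.Finite.coe_toFinset, LinearMap.image_convexHull,
    LinearMap.image_convexHull]

theorem isZonotope_Zperp (A : Matrix (Fin n) (Fin n) ℝ) : IsZonotope (residual A) (Zperp A) := by
  classical
  let E := Fintype.equivFin (Edge n)
  refine ⟨Fintype.card (Edge n),
    fun k => circProj n (EuclideanSpace.single (E.symm k) 1), ?_⟩
  have key : ∀ t : Fin (Fintype.card (Edge n)) → ℝ,
      residual A + ∑ k, t k • circProj n (EuclideanSpace.single (E.symm k) 1) =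
        circProj n (vec A + ∑ p, t (E p) • EuclideanSpace.single p (1 : ℝ)) := by
    intro t
    rw [map_add, map_sum, residual_eq, ← E.symm.sum_comp]
    simp
  have hcoord : ∀ (t : Edge n → ℝ) (p : Edge n),
      (vec A + ∑ q, t q • EuclideanSpace.single q (1 : ℝ)) p - vec A p = t p := by
    intro t p
    simp [Pi.single_apply]
  ext z
  simp only [key, Set.mem_ofPred_eq, Zperp_eq]
  constructor
  · rintro ⟨x, hx, rfl⟩
    refine ⟨fun k => x (E.symm k) - vec A (E.symm k), fun k => hx _, ?_⟩
    congr 1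
    ext p
    have := hcoord (fun q => x q - vec A q) p
    simp only [Equiv.symm_apply_apply]
    linarith
  · rintro ⟨t, ht, rfl⟩
    refine ⟨_, fun p => ?_, rfl⟩
    rw [hcoord fun p => t (E p)]
    exact ht _

theorem pointReflection_image_Zperp (A : Matrix (Fin n) (Fin n) ℝ) :
    Equiv.pointReflection (residual A) '' Zperp A = Zperp A := by
  have h : ∀ z ∈ Zperp A, Equiv.pointReflection (residual A) z ∈ Zperp A := by
    rintro _ ⟨x, hx, rfl⟩
    refine ⟨vec A + (vec A - x), fun p => ?_, ?_⟩
    · rw [← abs_neg]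
      simpa using hx p
    · change circProj n _ = _
      rw [map_add, map_sub, Equiv.pointReflection_apply, residual_eq]
      simp only [vsub_eq_sub, vadd_eq_add]
      rw [add_comm]; rfl
  refine Set.Subset.antisymm (Set.image_subset_iff.2 h) fun z hz => ⟨_, h z hz, ?_⟩
  exact Equiv.pointReflection_involutive _ z

/-- Dilating the projected cube about its centre amounts to projecting a larger cube. -/
theorem homothety_image_Zperp (A : Matrix (Fin n) (Fin n) ℝ) {r : ℝ} (hr : 0 < r) :
    AffineMap.homothety (residual A) r '' Zperp A = circProj n '' cube (vec A) r := by
  have hcomm : ∀ x, AffineMap.homothety (residual A) r (circProj n x) =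
      circProj n (AffineMap.homothety (vec A) r x) := by
    intro x
    simp only [AffineMap.homothety_apply, vsub_eq_sub, vadd_eq_add, residual_eq, map_add, map_smul,
      map_sub]
  have hc : ∀ (x : APCMSpace n) p,
      AffineMap.homothety (vec A) r x p - vec A p = r * (x p - vec A p) := by
    intro x p
    simp [AffineMap.homothety_apply]
  rw [Zperp_eq]
  ext z
  constructor
  · rintro ⟨_, ⟨x, hx, rfl⟩, rfl⟩
    refine ⟨_, fun p => ?_, (hcomm x).symm⟩
    rw [hc, abs_mul, abs_of_pos hr]
    exact mul_le_of_le_one_right hr.le (hx p)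
  · rintro ⟨x, hx, rfl⟩
    refine ⟨_, ⟨AffineMap.homothety (vec A) r⁻¹ x, fun p => ?_, rfl⟩, ?_⟩
    · have : AffineMap.homothety (vec A) r⁻¹ x p - vec A p = r⁻¹ * (x p - vec A p) := by
        simp [AffineMap.homothety_apply]
      rw [this, abs_mul, abs_of_pos (inv_pos.2 hr), inv_mul_le_iff₀ hr, mul_one]
      exact hx p
    · rw [hcomm, ← AffineMap.homothety_mul_apply, mul_inv_cancel₀ hr.ne', AffineMap.homothety_one]
      rfl

/-! ### Cycles -/

namespace DirectedCycle

theorem next_mem_iff (π : DirectedCycle n) {i : Fin n} : π.next i ∈ π.verts ↔ i ∈ π.verts := by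
  simpa using π.isCycleOn.apply_mem_iff (x := i)

theorem sum_comp_next (π : DirectedCycle n) (g : Fin n → ℝ) :
    ∑ i ∈ π.verts, g (π.next i) = ∑ i ∈ π.verts, g i :=
  Finset.sum_equiv π.next (fun _ => π.next_mem_iff.symm) fun _ _ => rfl

theorem length_pos (π : DirectedCycle n) : (0 : ℝ) < π.length :=
  Nat.cast_pos.2 (Finset.card_pos.2 π.nonempty)

theorem value_scoreMatrix (π : DirectedCycle n) (w : Fin n → ℝ) :
    π.value (scoreMatrix w) = 0 := by
  simp [value, scoreMatrix, Finset.sum_sub_distrib, π.sum_comp_next w]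

/-- A property that passes from each vertex of a cycle to its successor holds at all vertices as
soon as it holds at one. -/
theorem forall_mem_of_next (π : DirectedCycle n) {p : Fin n → Prop} {i : Fin n}
    (hi : i ∈ π.verts) (hp : p i) (hstep : ∀ j ∈ π.verts, p j → p (π.next j)) :
    ∀ j ∈ π.verts, p j := by
  intro j hj
  obtain ⟨k, -, rfl⟩ := π.isCycleOn.exists_pow_eq hi hj
  have h : ∀ k : ℕ, (π.next ^ k) i ∈ π.verts ∧ p ((π.next ^ k) i) := by
    intro k
    induction k with
    | zero => exact ⟨hi, hp⟩
    | succ k ih =>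
      rw [pow_succ', Equiv.Perm.mul_apply]
      exact ⟨π.next_mem_iff.2 ih.1, hstep _ ih.1 ih.2⟩
  exact (h k).2

/-- The value of a cycle, as a linear functional of the comparison matrix. -/
def valueMap (π : DirectedCycle n) : APCMSpace n →ₗ[ℝ] ℝ where
  toFun x := π.value (apcm x)
  map_add' x y := by simp [value, Finset.sum_add_distrib]
  map_smul' c x := by simp [value, Finset.mul_sum]

theorem valueMap_apply (π : DirectedCycle n) (x : APCMSpace n) :
    π.valueMap x = π.value (apcm x) := rfl

theorem valueMap_circProj (π : DirectedCycle n) (x : APCMSpace n) :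
    π.valueMap (circProj n x) = π.valueMap x := by
  rw [circProj_apply, map_sub, starProjection_ST, valueMap_apply π (vec _), apcm_vec_scoreMatrix,
    value_scoreMatrix, sub_zero]

end DirectedCycle

/-- If every element of a nonempty set has a successor in the set, then iterating a choice of
successors runs into a cycle. -/
theorem exists_directedCycle {R : Fin n → Fin n → Prop} {S : Set (Fin n)} (hS : S.Nonempty)
    (h : ∀ i ∈ S, ∃ j ∈ S, R i j) :
    ∃ π : DirectedCycle n, ∀ i ∈ π.verts, i ∈ S ∧ R i (π.next i) := by
  classical
  choose! g hgS hgR using h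
  let f : S → S := fun i => ⟨g i, hgS i i.2⟩
  obtain ⟨s₀, hs₀⟩ := hS
  obtain ⟨a, b, hne, hab⟩ := Finite.exists_ne_map_eq_of_infinite fun k : ℕ => f^[k] ⟨s₀, hs₀⟩
  wlog hlt : a < b generalizing a b
  · exact this b a hne.symm hab.symm (lt_of_le_of_ne (not_lt.1 hlt) hne.symm)
  set y := f^[a] ⟨s₀, hs₀⟩ with hy
  have hper : y ∈ Function.periodicPts f := by
    refine Function.mk_mem_periodicPts (n := b - a) (by omega) ?_
    change f^[b - a] y = y
    rw [hy, ← Function.iterate_add_apply, Nat.sub_add_cancel hlt.le]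
    exact hab.symm
  set p := Function.minimalPeriod f y
  have hp : 0 < p := Function.minimalPeriod_pos_of_mem_periodicPts hper
  let l : List (Fin n) := (List.range p).map fun k => (f^[k] y : Fin n)
  have hl : l.length = p := by simp [l]
  have hget : ∀ (k : ℕ) (hk : k < l.length), l[k] = (f^[k] y : Fin n) := by
    intro k hk; simp [l]
  have hnodup : l.Nodup := by
    refine (List.nodup_map_iff_inj_on List.nodup_range).2 fun i hi j hj hij => ?_
    exact Function.iterate_injOn_Iio_minimalPeriod (List.mem_range.1 hi) (List.mem_range.1 hj)
      (Subtype.ext hij)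
  refine ⟨⟨l.toFinset, l.formPerm, ?_, ?_, fun i hi => ?_⟩, fun i hi => ?_⟩
  · exact ⟨l[0]'(by omega), by simp⟩
  · simpa using hnodup.isCycleOn_formPerm
  · exact List.formPerm_apply_of_notMem (by simpa using hi)
  · obtain ⟨k, hk, rfl⟩ := List.getElem_of_mem (List.mem_toFinset.1 hi)
    have h1 : l.formPerm l[k] = (f^[k + 1] y : Fin n) := by
      rw [List.formPerm_apply_getElem _ hnodup, hget]
      congr 1
      rw [hl]
      exact Function.iterate_mod_minimalPeriod_eq
    rw [h1, hget, Function.iterate_succ_apply']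
    exact ⟨(f^[k] y).2, hgR _ (f^[k] y).2⟩

/-! ### Tropical eigenvectors and the maximal cycle mean -/

/-- A max-plus subeigenvector for `t`: `A i j + w j ≤ t + w i` for all `i`, `j`. -/
def IsSubeigenvector (A : Matrix (Fin n) (Fin n) ℝ) (t : ℝ) (w : Fin n → ℝ) : Prop :=
  ∀ i j, A i j + w j ≤ t + w i

/-- The slacks of the edges of a cycle sum to `t` times its length minus its value, because the
contributions of `w` cancel. -/
theorem sum_slack_eq (π : DirectedCycle n) (A : Matrix (Fin n) (Fin n) ℝ) (t : ℝ)
    (w : Fin n → ℝ) :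
    ∑ i ∈ π.verts, (t + w i - (A i (π.next i) + w (π.next i))) = t * π.length - π.value A := by
  rw [Finset.sum_sub_distrib, Finset.sum_add_distrib, Finset.sum_add_distrib, π.sum_comp_next w,
    Finset.sum_const, nsmul_eq_mul, DirectedCycle.length, DirectedCycle.value]
  ring

theorem IsSubeigenvector.value_le {A : Matrix (Fin n) (Fin n) ℝ} {t : ℝ} {w : Fin n → ℝ}
    (h : IsSubeigenvector A t w) (π : DirectedCycle n) : π.value A ≤ t * π.length := by
  rw [← sub_nonneg, ← sum_slack_eq π A t w]
  exact Finset.sum_nonneg fun i _ => sub_nonneg.2 (h i _)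

theorem value_eq_of_tight {A : Matrix (Fin n) (Fin n) ℝ} {t : ℝ} {w : Fin n → ℝ}
    {π : DirectedCycle n} (h : ∀ i ∈ π.verts, A i (π.next i) + w (π.next i) = t + w i) :
    π.value A = t * π.length := by
  have h1 := sum_slack_eq π A t w
  rw [Finset.sum_eq_zero fun i hi => by rw [h i hi, sub_self]] at h1
  linarith

theorem value_le_lambdaMax_mul (A : Matrix (Fin n) (Fin n) ℝ) (π : DirectedCycle n) :
    π.value A ≤ lambdaMax A * π.length := by
  have hn : 1 ≤ n := by
    obtain ⟨i, -⟩ := π.nonempty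
    have := i.pos
    omega
  rw [← div_le_iff₀ π.length_pos]
  exact (isGreatest_lambdaMax hn A).2 ⟨π, rfl⟩

theorem isCritical_iff (A : Matrix (Fin n) (Fin n) ℝ) (π : DirectedCycle n) :
    IsCritical A π ↔ π.value A = lambdaMax A * π.length :=
  div_eq_iff π.length_pos.ne'

theorem exists_isCritical (hn : 1 ≤ n) (A : Matrix (Fin n) (Fin n) ℝ) :
    ∃ π : DirectedCycle n, IsCritical A π :=
  (isGreatest_lambdaMax hn A).1

theorem IsSubeigenvector.lambdaMax_le (hn : 1 ≤ n) {A : Matrix (Fin n) (Fin n) ℝ} {t : ℝ}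
    {w : Fin n → ℝ} (h : IsSubeigenvector A t w) : lambdaMax A ≤ t := by
  obtain ⟨π, hπ⟩ := exists_isCritical hn A
  rw [← hπ, div_le_iff₀ π.length_pos]
  exact h.value_le π

/-- A set of vertices each of which has a tight edge into the set contains a cycle of mean `t`. -/
theorem le_lambdaMax_of_tight {A : Matrix (Fin n) (Fin n) ℝ} {t : ℝ} {w : Fin n → ℝ}
    {S : Set (Fin n)} (hS : S.Nonempty) (h : ∀ i ∈ S, ∃ j ∈ S, A i j + w j = t + w i) :
    t ≤ lambdaMax A := by
  obtain ⟨π, hπ⟩ := exists_directedCycle hS h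
  have h1 := value_eq_of_tight fun i hi => (hπ i hi).2
  have h2 := value_le_lambdaMax_mul A π
  rw [h1] at h2
  exact le_of_mul_le_mul_right h2 π.length_pos

/-- The least level at which a subeigenvector exists is attained, by compactness of the set of
normalized subeigenvectors of bounded level. -/
theorem exists_minimal_subeigenvector (hn : 1 ≤ n) (A : Matrix (Fin n) (Fin n) ℝ) :
    ∃ t w, IsSubeigenvector A t w ∧ ∀ t' w', IsSubeigenvector A t' w' → t ≤ t' := by
  let z : Fin n := ⟨0, hn⟩
  obtain ⟨T, hT⟩ : ∃ T, ∀ i j, A i j ≤ T := by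
    obtain ⟨T, hT⟩ := (Set.finite_range fun p : Fin n × Fin n => A p.1 p.2).bddAbove
    exact ⟨T, fun i j => hT ⟨(i, j), rfl⟩⟩
  let K : Set (ℝ × (Fin n → ℝ)) := {q | q.2 z = 0 ∧ IsSubeigenvector A q.1 q.2 ∧ q.1 ≤ T}
  have hclosed : IsClosed K := by
    refine IsClosed.inter (isClosed_eq (by fun_prop) continuous_const)
      (IsClosed.inter ?_ (isClosed_le continuous_fst continuous_const))
    have : {q : ℝ × (Fin n → ℝ) | IsSubeigenvector A q.1 q.2} =
        ⋂ i, ⋂ j, {q : ℝ × (Fin n → ℝ) | A i j + q.2 j ≤ q.1 + q.2 i} := by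
      ext q; simp [IsSubeigenvector]
    change IsClosed {q : ℝ × (Fin n → ℝ) | IsSubeigenvector A q.1 q.2}
    rw [this]
    exact isClosed_iInter fun i => isClosed_iInter fun j =>
      isClosed_le (by fun_prop) (by fun_prop)
  have hsub : K ⊆ Set.Icc (A z z, fun i => A i z - T) (T, fun i => T - A z i) := by
    rintro ⟨t, w⟩ ⟨h0, hw, ht⟩
    dsimp only at h0 hw ht
    refine ⟨⟨?_, fun i => ?_⟩, ⟨ht, fun i => ?_⟩⟩
    · have := hw z z; dsimp only; linarith
    · have := hw i z; dsimp only; linarith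
    · have := hw z i; dsimp only; linarith
  have hne : K.Nonempty := ⟨(T, 0), rfl, fun i j => by simpa using hT i j, le_rfl⟩
  obtain ⟨⟨t, w⟩, ⟨-, hw, htT⟩, hmin⟩ :=
    (isCompact_Icc.of_isClosed_subset hclosed hsub).exists_isMinOn hne continuous_fst.continuousOn
  refine ⟨t, w, hw, fun t' w' h' => ?_⟩
  rcases le_total t' T with ht' | ht'
  · refine hmin (show (t', fun i => w' i - w' z) ∈ K from ⟨sub_self _, fun i j => ?_, ht'⟩)
    have := h' i j
    dsimp only
    linarith
  · exact htT.trans ht'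

/-- At the least level, a subeigenvector with as few tight vertices as possible has a nonempty
set of tight vertices, each with a tight edge into this set: lowering all other coordinates a
little would otherwise destroy some tight vertex without creating one. -/
theorem exists_tight_set (hn : 1 ≤ n) (A : Matrix (Fin n) (Fin n) ℝ) :
    ∃ (t : ℝ) (w : Fin n → ℝ) (S : Set (Fin n)), IsSubeigenvector A t w ∧ S.Nonempty ∧
      ∀ i ∈ S, ∃ j ∈ S, A i j + w j = t + w i := by
  classical
  obtain ⟨t, w₀, hw₀, hmin⟩ := exists_minimal_subeigenvector hn A
  let S : (Fin n → ℝ) → Finset (Fin n) := fun w =>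
    Finset.univ.filter fun i => ∃ j, A i j + w j = t + w i
  have hS : ∀ w i, i ∈ S w ↔ ∃ j, A i j + w j = t + w i := fun w i => by simp [S]
  obtain ⟨w, hw, hwmin⟩ : ∃ w, IsSubeigenvector A t w ∧
      ∀ w', IsSubeigenvector A t w' → (S w).card ≤ (S w').card := by
    have hwf := WellFounded.has_min (measure fun w => (S w).card).wf
      {w | IsSubeigenvector A t w} ⟨w₀, hw₀⟩
    obtain ⟨w, hw, h⟩ := hwf
    exact ⟨w, hw, fun w' hw' => not_lt.1 (h w' hw')⟩
  -- a common positive lower bound for the slacks of all edges leaving a vertex that is not tight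
  obtain ⟨ε, hε, hεw⟩ : ∃ ε > 0, ∀ i ∉ S w, ∀ j, A i j + w j + ε ≤ t + w i := by
    have : ∀ p : Fin n × Fin n, ∃ ε > 0, p.1 ∉ S w → A p.1 p.2 + w p.2 + ε ≤ t + w p.1 := by
      intro p
      by_cases hp : p.1 ∈ S w
      · exact ⟨1, one_pos, fun h => absurd hp h⟩
      · refine ⟨t + w p.1 - (A p.1 p.2 + w p.2), ?_, fun _ => by linarith⟩
        refine sub_pos.2 (lt_of_le_of_ne (hw _ _) fun h => hp ((hS _ _).2 ⟨_, h⟩))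
    choose e he0 he using this
    have : Nonempty (Fin n) := ⟨⟨0, hn⟩⟩
    refine ⟨Finset.univ.inf' Finset.univ_nonempty e, (Finset.lt_inf'_iff _).2 fun p _ => he0 p,
      fun i hi j => ?_⟩
    have h1 := he (i, j) hi
    have h2 : Finset.univ.inf' Finset.univ_nonempty e ≤ e (i, j) :=
      Finset.inf'_le _ (Finset.mem_univ _)
    dsimp only at h1
    linarith
  refine ⟨t, w, S w, hw, ?_, fun i hi => ?_⟩
  · by_contra hempty
    rw [Set.not_nonempty_iff_eq_empty, Finset.coe_eq_empty] at hempty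
    have := hmin (t - ε) w fun i j => by
      have := hεw i (by simp [hempty]) j
      linarith
    linarith
  · by_contra! hcon
    let w' : Fin n → ℝ := fun j => if j ∈ S w then w j else w j - ε / 2
    have hin : ∀ j ∈ S w, w' j = w j := fun j hj => by simp [w', hj]
    have hout : ∀ j ∉ S w, w' j = w j - ε / 2 := fun j hj => by simp [w', hj]
    have hle : ∀ j, w' j ≤ w j := fun j => by
      by_cases hj : j ∈ S w
      · rw [hin j hj]
      · rw [hout j hj]; linarith
    have hw' : IsSubeigenvector A t w' := by
      intro k j
      by_cases hk : k ∈ S w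
      · rw [hin k hk]; linarith [hw k j, hle j]
      · rw [hout k hk]; linarith [hεw k hk j, hle j]
    have hss : S w' ⊂ S w := by
      rw [Finset.ssubset_iff_of_subset]
      · refine ⟨i, hi, fun hi' => ?_⟩
        obtain ⟨j, hj⟩ := (hS _ _).1 hi'
        rw [hin i hi] at hj
        by_cases hjS : j ∈ S w
        · rw [hin j hjS] at hj
          exact hcon j hjS hj
        · rw [hout j hjS] at hj
          linarith [hw i j]
      · intro k hk
        by_contra hkS
        obtain ⟨j, hj⟩ := (hS _ _).1 hk
        rw [hout k hkS] at hj
        linarith [hεw k hkS j, hle j]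
    exact absurd (hwmin w' hw') (not_le.2 (Finset.card_lt_card hss))

/-- A tight set can be enlarged until it contains all vertices: lower the coordinates outside the
set until some edge into the set becomes tight. The result is a tropical eigenvector. -/
theorem exists_isTropicalEigenpair (hn : 1 ≤ n) (A : Matrix (Fin n) (Fin n) ℝ) :
    ∃ t w, IsTropicalEigenpair A t w := by
  classical
  obtain ⟨t, w₀, S₀, hw₀, hS₀, htight₀⟩ := exists_tight_set hn A
  -- the pairs of a subeigenvector and a tight set, ordered by the number of missing vertices
  let X : Set ((Fin n → ℝ) × Finset (Fin n)) := {q | IsSubeigenvector A t q.1 ∧ q.2.Nonempty ∧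
    ∀ i ∈ q.2, ∃ j ∈ q.2, A i j + q.1 j = t + q.1 i}
  have hX : X.Nonempty := ⟨(w₀, S₀.toFinset), hw₀, by simpa using hS₀, by simpa using htight₀⟩
  obtain ⟨⟨w, S⟩, ⟨hw, hSne, htight⟩, hmax⟩ := WellFounded.has_min
    (measure fun q : (Fin n → ℝ) × Finset (Fin n) => q.2ᶜ.card).wf X hX
  dsimp only at hw hSne htight
  have huniv : ∀ i, i ∈ S := by
    by_contra! hcon
    have hcross : (Sᶜ ×ˢ S).Nonempty := by
      obtain ⟨i, hi⟩ := hcon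
      exact Finset.Nonempty.product ⟨i, Finset.mem_compl.2 hi⟩ hSne
    obtain ⟨⟨a, b⟩, hab, hmin⟩ := Finset.exists_min_image (Sᶜ ×ˢ S)
      (fun p => t + w p.1 - (A p.1 p.2 + w p.2)) hcross
    dsimp only at hmin
    obtain ⟨ha, hb⟩ := Finset.mem_product.1 hab
    rw [Finset.mem_compl] at ha
    dsimp only at ha hb
    set δ := t + w a - (A a b + w b) with hδ
    have hδ0 : 0 ≤ δ := sub_nonneg.2 (hw a b)
    let w' : Fin n → ℝ := fun j => if j ∈ S then w j else w j - δ
    have hin : ∀ j ∈ S, w' j = w j := fun j hj => by simp [w', hj]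
    have hout : ∀ j ∉ S, w' j = w j - δ := fun j hj => by simp [w', hj]
    refine hmax (w', insert a S) ⟨fun k j => ?_, Finset.insert_nonempty _ _, fun k hk => ?_⟩ ?_
    · change A k j + w' j ≤ t + w' k
      by_cases hk : k ∈ S <;> by_cases hj : j ∈ S
      · rw [hin k hk, hin j hj]; exact hw k j
      · rw [hin k hk, hout j hj]; linarith [hw k j]
      · rw [hout k hk, hin j hj]
        have := hmin (k, j) (Finset.mem_product.2 ⟨Finset.mem_compl.2 hk, hj⟩)
        dsimp only at this
        linarith
      · rw [hout k hk, hout j hj]; linarith [hw k j]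
    · dsimp only at hk ⊢
      rcases Finset.mem_insert.1 hk with rfl | hk
      · refine ⟨b, Finset.mem_insert_of_mem hb, ?_⟩
        rw [hin b hb, hout k ha, hδ]; ring
      · obtain ⟨j, hj, hkj⟩ := htight k hk
        exact ⟨j, Finset.mem_insert_of_mem hj, by rw [hin j hj, hin k hk, hkj]⟩
    · refine Finset.card_lt_card ?_
      rw [Finset.compl_ssubset_compl]
      exact Finset.ssubset_insert ha
  refine ⟨t, w, fun i => ⟨?_, ?_⟩⟩
  · obtain ⟨j, -, hj⟩ := htight i (huniv i)
    exact ⟨j, hj⟩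
  · rintro _ ⟨j, rfl⟩
    exact hw i j

theorem IsTropicalEigenpair.isSubeigenvector {A : Matrix (Fin n) (Fin n) ℝ} {μ : ℝ}
    {m : Fin n → ℝ} (h : IsTropicalEigenpair A μ m) : IsSubeigenvector A μ m :=
  fun i j => (h i).2 ⟨j, rfl⟩

theorem IsTropicalEigenpair.eq_lambdaMax (hn : 1 ≤ n) {A : Matrix (Fin n) (Fin n) ℝ} {μ : ℝ}
    {m : Fin n → ℝ} (h : IsTropicalEigenpair A μ m) : μ = lambdaMax A := by
  refine le_antisymm (le_lambdaMax_of_tight (w := m) (S := Set.univ) ⟨⟨0, hn⟩, trivial⟩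
    fun i _ => ?_) (h.isSubeigenvector.lambdaMax_le hn)
  obtain ⟨j, hj⟩ := (h i).1
  exact ⟨j, trivial, hj⟩

theorem exists_isTropicalEigenpair_iff (hn : 1 ≤ n) (A : Matrix (Fin n) (Fin n) ℝ) (μ : ℝ) :
    (∃ m, IsTropicalEigenpair A μ m) ↔ μ = lambdaMax A := by
  constructor
  · rintro ⟨m, hm⟩
    exact hm.eq_lambdaMax hn
  · rintro rfl
    obtain ⟨t, w, h⟩ := exists_isTropicalEigenpair hn A
    exact ⟨w, h.eq_lambdaMax hn ▸ h⟩

theorem exists_isSubeigenvector_iff (hn : 1 ≤ n) (A : Matrix (Fin n) (Fin n) ℝ) (t : ℝ) :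
    (∃ w, IsSubeigenvector A t w) ↔ lambdaMax A ≤ t := by
  constructor
  · rintro ⟨w, hw⟩
    exact hw.lambdaMax_le hn
  · intro h
    obtain ⟨m, hm⟩ := (exists_isTropicalEigenpair_iff hn A _).2 rfl
    exact ⟨m, fun i j => (hm.isSubeigenvector i j).trans (by gcongr)⟩

/-! ### The gauge of the projected cube -/

/-- The projected cube of half side `r` contains the origin exactly when the comparison matrix is
within `r` of a strongly transitive one; by skew-symmetry the scores form a subeigenvector. -/
theorem zero_mem_circProj_image_cube_iff {A : Matrix (Fin n) (Fin n) ℝ} (hA : A.transpose = -A)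
    {r : ℝ} (hr : 0 ≤ r) :
    0 ∈ circProj n '' cube (vec A) r ↔ ∃ w, IsSubeigenvector A r w := by
  constructor
  · rintro ⟨x, hx, hx0⟩
    obtain ⟨w, hw⟩ := mem_ST_iff.1 (circProj_eq_zero_iff.1 hx0)
    refine ⟨w, fun i j => ?_⟩
    have h := (mem_cube_iff hr).1 hx i j
    rw [hw, apcm_vec hA] at h
    have h' := (abs_le.1 h).1
    simp only [scoreMatrix, Matrix.of_apply] at h'
    linarith
  · rintro ⟨w, hw⟩
    refine ⟨vec (scoreMatrix w), (mem_cube_iff hr).2 fun i j => ?_,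
      circProj_eq_zero_iff.2 (vec_scoreMatrix_mem_ST w)⟩
    rw [apcm_vec_scoreMatrix, apcm_vec hA, abs_le]
    have h1 := hw i j
    have h2 := hw j i
    rw [skew_apply hA i j] at h2
    simp only [scoreMatrix, Matrix.of_apply]
    constructor <;> linarith

theorem lambdaMax_nonneg (hn : 1 ≤ n) {A : Matrix (Fin n) (Fin n) ℝ} (hA : A.transpose = -A) :
    0 ≤ lambdaMax A := by
  obtain ⟨m, hm⟩ := (exists_isTropicalEigenpair_iff hn A _).2 rfl
  have h := hm.isSubeigenvector ⟨0, hn⟩ ⟨0, hn⟩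
  have h0 := skew_apply hA ⟨0, hn⟩ ⟨0, hn⟩
  linarith

theorem lambdaMax_pos (hn : 1 ≤ n) {A : Matrix (Fin n) (Fin n) ℝ} (hA : A.transpose = -A)
    (hST : vec A ∉ ST n) : 0 < lambdaMax A := by
  refine lt_of_le_of_ne (lambdaMax_nonneg hn hA) fun h0 => hST ?_
  obtain ⟨w, hw⟩ := (exists_isSubeigenvector_iff hn A 0).2 h0.symm.le
  refine mem_ST_iff.2 ⟨w, ?_⟩
  rw [apcm_vec hA]
  ext i j
  have h1 := hw i j
  have h2 := hw j i
  rw [skew_apply hA i j] at h2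
  simp only [scoreMatrix, Matrix.of_apply]
  linarith

open scoped Pointwise in
theorem gauge_Zperp (hn : 1 ≤ n) {A : Matrix (Fin n) (Fin n) ℝ} (hA : A.transpose = -A) :
    gauge ((fun z => z - residual A) '' Zperp A) (0 - residual A) = lambdaMax A := by
  have hmem : ∀ r : ℝ, 0 < r →
      ((0 - residual A ∈ r • ((fun z => z - residual A) '' Zperp A)) ↔ lambdaMax A ≤ r) := by
    intro r hr
    rw [← exists_isSubeigenvector_iff hn, ← zero_mem_circProj_image_cube_iff hA hr.le,
      ← homothety_image_Zperp A hr]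
    constructor
    · rintro ⟨_, ⟨z, hz, rfl⟩, h⟩
      refine ⟨z, hz, ?_⟩
      rw [AffineMap.homothety_apply, vsub_eq_sub, vadd_eq_add]
      rw [show r • (z - residual A) = 0 - residual A from h]
      simp
    · rintro ⟨z, hz, h⟩
      refine ⟨_, ⟨z, hz, rfl⟩, ?_⟩
      rw [AffineMap.homothety_apply, vsub_eq_sub, vadd_eq_add] at h
      exact eq_sub_of_add_eq h
  rw [gauge_def]
  have h0 := lambdaMax_nonneg hn hA
  rcases h0.eq_or_lt with h0 | h0
  · have : {r ∈ Set.Ioi (0 : ℝ) | 0 - residual A ∈ r • ((fun z => z - residual A) '' Zperp A)} =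
        Set.Ioi 0 := by
      ext r
      exact ⟨fun h => h.1, fun h => ⟨h, (hmem r h).2 (h0 ▸ le_of_lt h)⟩⟩
    rw [this, csInf_Ioi, h0]
  · have : {r ∈ Set.Ioi (0 : ℝ) | 0 - residual A ∈ r • ((fun z => z - residual A) '' Zperp A)} =
        Set.Ici (lambdaMax A) := by
      ext r
      exact ⟨fun h => (hmem r h.1).1 h.2, fun h => ⟨h0.trans_le h, (hmem r (h0.trans_le h)).2 h⟩⟩
    rw [this, csInf_Ici]

/-! ### The circulation of a cycle -/

namespace DirectedCycle

/-- The skew-symmetric matrix of the unit circulation along a cycle. -/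
noncomputable def circMatrix (π : DirectedCycle n) : Matrix (Fin n) (Fin n) ℝ :=
  Matrix.of fun i j =>
    (if i ∈ π.verts ∧ π.next i = j then 1 else 0) - if j ∈ π.verts ∧ π.next j = i then 1 else 0

theorem circMatrix_swap (π : DirectedCycle n) (i j : Fin n) :
    π.circMatrix j i = -π.circMatrix i j := by
  simp [circMatrix]

theorem abs_circMatrix_le_one (π : DirectedCycle n) (i j : Fin n) : |π.circMatrix i j| ≤ 1 := by
  simp only [circMatrix, Matrix.of_apply]
  split_ifs <;> norm_num

/-- The value of a cycle is the inner product with its circulation. -/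
theorem inner_circMatrix (π : DirectedCycle n) (x : APCMSpace n) :
    inner ℝ (vec π.circMatrix) x = π.valueMap x := by
  have h1 : ∑ i, ∑ j, (if i ∈ π.verts ∧ π.next i = j then (1 : ℝ) else 0) * apcm x i j =
      π.value (apcm x) := by
    simp [value, ite_and]
  have h2 : ∑ i, ∑ j, (if j ∈ π.verts ∧ π.next j = i then (1 : ℝ) else 0) * apcm x i j =
      -π.value (apcm x) := by
    rw [← h1, Finset.sum_comm]
    simp only [← Finset.sum_neg_distrib]
    exact Finset.sum_congr rfl fun i _ => Finset.sum_congr rfl fun j _ => by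
      rw [apcm_swap x i j]; ring
  have h := sum_sum_apcm_mul_apcm (vec π.circMatrix) x
  rw [apcm_vec_of_swap π.circMatrix_swap] at h
  simp only [circMatrix, Matrix.of_apply, sub_mul, Finset.sum_sub_distrib] at h
  rw [h1, h2] at h
  rw [valueMap_apply]
  change _ = 2 * inner ℝ (vec π.circMatrix) x at h
  linarith

/-- On skew-symmetric matrices, cycles of length one and two have value zero. -/
theorem next_next_ne (π : DirectedCycle n) {A : Matrix (Fin n) (Fin n) ℝ}
    (hA : A.transpose = -A) (hv : π.value A ≠ 0) {i : Fin n} (hi : i ∈ π.verts) :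
    π.next (π.next i) ≠ i := by
  intro h
  have hall := π.forall_mem_of_next (p := fun j => π.next (π.next j) = j) hi h
    fun j _ hj => congrArg π.next hj
  refine hv ?_
  have h1 := π.sum_comp_next fun j => A j (π.next j)
  have h2 : ∑ j ∈ π.verts, A (π.next j) (π.next (π.next j)) = -π.value A := by
    rw [value, ← Finset.sum_neg_distrib]
    exact Finset.sum_congr rfl fun j hj => by rw [hall j hj, skew_apply hA]
  rw [h2] at h1
  change -π.value A = π.value A at h1
  linarith

variable {π : DirectedCycle n}

theorem circMatrix_next (h : ∀ i ∈ π.verts, π.next (π.next i) ≠ i) {i : Fin n}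
    (hi : i ∈ π.verts) : π.circMatrix i (π.next i) = 1 := by
  simp [circMatrix, hi, h i hi]

theorem circMatrix_ne_zero {i j : Fin n} (h : π.circMatrix i j ≠ 0) :
    (i ∈ π.verts ∧ π.next i = j) ∨ (j ∈ π.verts ∧ π.next j = i) := by
  by_contra! hcon
  refine h ?_
  simp only [circMatrix, Matrix.of_apply]
  rw [if_neg fun h => hcon.1 h.1 h.2, if_neg fun h => hcon.2 h.1 h.2, sub_zero]

theorem circMatrix_eq_one {i j : Fin n} (h : π.circMatrix i j = 1) :
    i ∈ π.verts ∧ π.next i = j := by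
  by_contra hcon
  simp only [circMatrix, Matrix.of_apply, if_neg hcon] at h
  split_ifs at h <;> norm_num at h

/-- By conservation of flow, a circulation supported on the edges of a cycle is constant along
the cycle. -/
theorem eq_smul_circMatrix (h : ∀ i ∈ π.verts, π.next (π.next i) ≠ i) {y : APCMSpace n}
    (hy : y ∈ (ST n)ᗮ) (hsupp : ∀ i j, π.circMatrix i j = 0 → apcm y i j = 0) :
    ∃ s : ℝ, y = s • vec π.circMatrix := by
  obtain ⟨i₀, hi₀⟩ := π.nonempty
  have hconst := π.forall_mem_of_next
    (p := fun i => apcm y i (π.next i) = apcm y i₀ (π.next i₀)) hi₀ rfl fun i hi hp => by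
      have hrow := mem_ST_orthogonal_iff.1 hy (π.next i)
      rw [Fintype.sum_eq_add i (π.next (π.next i)) (h i hi).symm] at hrow
      · rw [apcm_swap y i, hp] at hrow
        linarith
      · rintro k ⟨hk1, hk2⟩
        refine hsupp _ _ ?_
        by_contra hne
        rcases circMatrix_ne_zero hne with hk | hk
        · exact hk2 hk.2.symm
        · exact hk1 (π.next.injective hk.2)
  refine ⟨apcm y i₀ (π.next i₀), apcm_injective ?_⟩
  rw [map_smul, apcm_vec_of_swap π.circMatrix_swap]
  ext i j
  rw [Matrix.smul_apply, smul_eq_mul]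
  by_cases h0 : π.circMatrix i j = 0
  · rw [h0, hsupp i j h0, mul_zero]
  · rcases circMatrix_ne_zero h0 with ⟨hi, rfl⟩ | ⟨hj, rfl⟩
    · rw [circMatrix_next h hi, hconst i hi, mul_one]
    · rw [circMatrix_swap π j, circMatrix_next h hj, apcm_swap y j, hconst j hj, mul_neg_one]

end DirectedCycle

/-! ### Facets of the dilated zonotope through the origin -/

/-- The dilate of `Z_⊥` by the maximal cycle mean, as the projection of a cube. -/
noncomputable abbrev dilatedZperp (A : Matrix (Fin n) (Fin n) ℝ) : Set (APCMSpace n) :=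
  circProj n '' cube (vec A) (lambdaMax A)

theorem zero_mem_dilatedZperp (hn : 1 ≤ n) {A : Matrix (Fin n) (Fin n) ℝ}
    (hA : A.transpose = -A) : 0 ∈ dilatedZperp A :=
  (zero_mem_circProj_image_cube_iff hA (lambdaMax_nonneg hn hA)).2
    ((exists_isSubeigenvector_iff hn A _).2 le_rfl)

section Critical

variable {A : Matrix (Fin n) (Fin n) ℝ} {π : DirectedCycle n}

theorem sum_sub_add_lambdaMax (hπ : IsCritical A π) (x : APCMSpace n) :
    ∑ i ∈ π.verts, (apcm x i (π.next i) - A i (π.next i) + lambdaMax A) = π.valueMap x := by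
  rw [isCritical_iff] at hπ
  rw [Finset.sum_add_distrib, Finset.sum_sub_distrib, Finset.sum_const, nsmul_eq_mul]
  change π.valueMap x - π.value A + π.length * lambdaMax A = _
  rw [hπ]; ring

theorem sub_add_lambdaMax_nonneg (hn : 1 ≤ n) (hA : A.transpose = -A) {x : APCMSpace n}
    (hx : x ∈ cube (vec A) (lambdaMax A)) (i j : Fin n) :
    0 ≤ apcm x i j - A i j + lambdaMax A := by
  have h := (mem_cube_iff (lambdaMax_nonneg hn hA)).1 hx i j
  rw [apcm_vec hA] at h
  linarith [(abs_le.1 h).1]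

theorem valueMap_nonneg_of_mem_cube (hn : 1 ≤ n) (hA : A.transpose = -A) (hπ : IsCritical A π)
    {x : APCMSpace n} (hx : x ∈ cube (vec A) (lambdaMax A)) : 0 ≤ π.valueMap x := by
  rw [← sum_sub_add_lambdaMax hπ]
  exact Finset.sum_nonneg fun i _ => sub_add_lambdaMax_nonneg hn hA hx i _

theorem valueMap_eq_zero_iff_of_mem_cube (hn : 1 ≤ n) (hA : A.transpose = -A)
    (hπ : IsCritical A π) {x : APCMSpace n} (hx : x ∈ cube (vec A) (lambdaMax A)) :
    π.valueMap x = 0 ↔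
      ∀ i ∈ π.verts, apcm x i (π.next i) = A i (π.next i) - lambdaMax A := by
  rw [← sum_sub_add_lambdaMax hπ,
    Finset.sum_eq_zero_iff_of_nonneg fun i _ => sub_add_lambdaMax_nonneg hn hA hx i _]
  exact forall₂_congr fun i _ => ⟨fun h => by linarith, fun h => by linarith⟩

/-- Since a critical cycle has nonnegative value on the dilated zonotope and value zero at the
origin, its face is the set where its value vanishes. -/
theorem cycleFace_dilatedZperp (hn : 1 ≤ n) (hA : A.transpose = -A) (hπ : IsCritical A π) :
    cycleFace (dilatedZperp A) π = {y ∈ dilatedZperp A | π.valueMap y = 0} := by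
  have hnonneg : ∀ y ∈ dilatedZperp A, 0 ≤ π.valueMap y := by
    rintro _ ⟨x, hx, rfl⟩
    rw [π.valueMap_circProj]
    exact valueMap_nonneg_of_mem_cube hn hA hπ hx
  ext y
  constructor
  · rintro ⟨hy, hmin⟩
    have h := hmin 0 (zero_mem_dilatedZperp hn hA)
    rw [← π.valueMap_apply, ← π.valueMap_apply, map_zero] at h
    exact ⟨hy, le_antisymm h (hnonneg y hy)⟩
  · rintro ⟨hy, hy0⟩
    refine ⟨hy, fun z hz => ?_⟩
    rw [← π.valueMap_apply, ← π.valueMap_apply, hy0]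
    exact hnonneg z hz

theorem IsCritical.next_next_ne (hA : A.transpose = -A) (hpos : 0 < lambdaMax A)
    (hπ : IsCritical A π) : ∀ i ∈ π.verts, π.next (π.next i) ≠ i := fun _ hi =>
  π.next_next_ne hA (by
    rw [(isCritical_iff A π).1 hπ]
    exact (mul_pos hpos π.length_pos).ne') hi

/-- The centre of the face of the cube on which the value of a critical cycle vanishes. -/
noncomputable def faceCenter (A : Matrix (Fin n) (Fin n) ℝ) (π : DirectedCycle n) : APCMSpace n :=
  vec A - lambdaMax A • vec π.circMatrix

theorem apcm_faceCenter (hA : A.transpose = -A) (i j : Fin n) :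
    apcm (faceCenter A π) i j = A i j - lambdaMax A * π.circMatrix i j := by
  rw [faceCenter, map_sub, map_smul, apcm_vec hA, apcm_vec_of_swap π.circMatrix_swap]
  rfl

theorem faceCenter_mem_cube (hn : 1 ≤ n) (hA : A.transpose = -A) :
    faceCenter A π ∈ cube (vec A) (lambdaMax A) := by
  have h0 := lambdaMax_nonneg hn hA
  rw [mem_cube_iff h0]
  intro i j
  rw [apcm_faceCenter hA, apcm_vec hA, sub_sub_cancel_left, abs_neg, abs_mul, abs_of_nonneg h0]
  exact mul_le_of_le_one_right h0 (π.abs_circMatrix_le_one i j)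

theorem valueMap_faceCenter (hn : 1 ≤ n) (hA : A.transpose = -A) (hpos : 0 < lambdaMax A)
    (hπ : IsCritical A π) : π.valueMap (faceCenter A π) = 0 := by
  rw [valueMap_eq_zero_iff_of_mem_cube hn hA hπ (faceCenter_mem_cube hn hA)]
  intro i hi
  rw [apcm_faceCenter hA, DirectedCycle.circMatrix_next (hπ.next_next_ne hA hpos) hi, mul_one]

theorem vectorSpan_dilatedZperp_le : vectorSpan ℝ (dilatedZperp A) ≤ (ST n)ᗮ := by
  rw [vectorSpan_def, Submodule.span_le]
  rintro _ ⟨_, ⟨x, -, rfl⟩, _, ⟨y, -, rfl⟩, rfl⟩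
  exact Submodule.sub_mem _ (circProj_mem x) (circProj_mem y)

/-- The face of a critical cycle contains all directions orthogonal to the circulation of the
cycle: the edges off the cycle are free on the corresponding face of the cube, and a circulation
vanishing on all of them is a multiple of that of the cycle. -/
theorem vectorSpan_cycleFace (hn : 1 ≤ n) (hA : A.transpose = -A) (hpos : 0 < lambdaMax A)
    (hπ : IsCritical A π) :
    vectorSpan ℝ (cycleFace (dilatedZperp A) π) =
      vectorSpan ℝ (dilatedZperp A) ⊓ LinearMap.ker π.valueMap := by
  have hnn := hπ.next_next_ne hA hpos
  have hF := cycleFace_dilatedZperp hn hA hπ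
  set F := cycleFace (dilatedZperp A) π
  refine le_antisymm (le_inf (vectorSpan_mono ℝ fun y hy => hy.1) ?_) ?_
  · rw [vectorSpan_def, Submodule.span_le]
    rintro _ ⟨y, hy, z, hz, rfl⟩
    rw [hF] at hy hz
    simp [hy.2, hz.2]
  · intro v ⟨hv, hv0⟩
    rw [← Submodule.orthogonal_orthogonal (vectorSpan ℝ F), Submodule.mem_orthogonal]
    intro y hy
    have hfree : ∀ p : Edge n, π.circMatrix p.1.1 p.1.2 = 0 →
        circProj n (EuclideanSpace.single p 1) ∈ vectorSpan ℝ F := by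
      intro p hp
      set x := faceCenter A π + lambdaMax A • EuclideanSpace.single p (1 : ℝ) with hx
      have hxcube : x ∈ cube (vec A) (lambdaMax A) := by
        intro q
        by_cases hq : q = p
        · subst hq
          simp [hx, faceCenter, vec, hp, abs_of_pos hpos]
        · have := faceCenter_mem_cube (π := π) hn hA q
          simpa [hx, hq] using this
      have hxval : π.valueMap x = 0 := by
        rw [hx, map_add, map_smul, valueMap_faceCenter hn hA hpos hπ, ← π.inner_circMatrix,
          EuclideanSpace.inner_single_right]
        simp [vec, hp]
      have h1 : circProj n x ∈ F := by
        rw [hF]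
        exact ⟨⟨x, hxcube, rfl⟩, by rw [π.valueMap_circProj, hxval]⟩
      have h2 : circProj n (faceCenter A π) ∈ F := by
        rw [hF]
        exact ⟨⟨_, faceCenter_mem_cube hn hA, rfl⟩, by
          rw [π.valueMap_circProj, valueMap_faceCenter hn hA hpos hπ]⟩
      have h3 := vsub_mem_vectorSpan ℝ h1 h2
      rw [vsub_eq_sub, ← map_sub, hx, add_sub_cancel_left, map_smul] at h3
      exact (Submodule.smul_mem_iff _ hpos.ne').1 h3
    have hsupp : ∀ p : Edge n, π.circMatrix p.1.1 p.1.2 = 0 → (circProj n y) p = 0 := by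
      intro p hp
      have h1 : inner ℝ (circProj n (EuclideanSpace.single p 1)) y = 0 :=
        (Submodule.mem_orthogonal _ _).1 hy _ (hfree p hp)
      rw [← inner_circProj_right (circProj_mem _), real_inner_comm,
        inner_circProj_right (circProj_mem _), EuclideanSpace.inner_single_right] at h1
      simpa using h1
    obtain ⟨s, hs⟩ := DirectedCycle.eq_smul_circMatrix hnn (circProj_mem y) fun i j hij => by
      rcases lt_trichotomy i j with h | h | h
      · rw [apcm_apply_of_lt _ h]
        exact hsupp ⟨(i, j), h⟩ hij
      · subst h; exact apcm_self _ _
      · rw [apcm_swap, apcm_apply_of_lt _ h, hsupp ⟨(j, i), h⟩ (by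
          rw [π.circMatrix_swap i j, hij, neg_zero]), neg_zero]
    rw [real_inner_comm, ← inner_circProj_right (vectorSpan_dilatedZperp_le hv), hs,
      inner_smul_right, real_inner_comm, π.inner_circMatrix, LinearMap.mem_ker.1 hv0, mul_zero]

theorem finrank_inf_ker_add_one {E : Type*} [AddCommGroup E] [Module ℝ E] [FiniteDimensional ℝ E]
    (V : Submodule ℝ E) (f : E →ₗ[ℝ] ℝ) {v : E} (hv : v ∈ V) (hf : f v ≠ 0) :
    Module.finrank ℝ ↥(V ⊓ LinearMap.ker f) + 1 = Module.finrank ℝ V := by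
  have hne : f.domRestrict V ≠ 0 := fun h => hf (by
    simpa using LinearMap.congr_fun h ⟨v, hv⟩)
  rw [← Module.Dual.finrank_ker_add_one_of_ne_zero hne, ← Submodule.map_comap_subtype,
    Submodule.finrank_map_subtype_eq]
  rfl

theorem isFacet_cycleFace (hn : 1 ≤ n) (hA : A.transpose = -A) (hpos : 0 < lambdaMax A)
    (hπ : IsCritical A π) :
    IsFacet (dilatedZperp A) (cycleFace (dilatedZperp A) π) ∧
      0 ∈ cycleFace (dilatedZperp A) π := by
  have h0 : 0 ∈ cycleFace (dilatedZperp A) π := by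
    rw [cycleFace_dilatedZperp hn hA hπ]
    exact ⟨zero_mem_dilatedZperp hn hA, map_zero _⟩
  refine ⟨⟨⟨0, h0⟩, fun _ => ⟨-(LinearMap.toContinuousLinearMap π.valueMap), ?_⟩, ?_⟩, h0⟩
  · ext y
    simp [cycleFace, DirectedCycle.valueMap_apply]
  · rw [vectorSpan_cycleFace hn hA hpos hπ]
    have hc : circProj n (vec A) ∈ dilatedZperp A :=
      ⟨_, fun p => by simpa using hpos.le, rfl⟩
    refine finrank_inf_ker_add_one _ _
      (vsub_mem_vectorSpan ℝ hc (zero_mem_dilatedZperp hn hA)) ?_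
    rw [vsub_eq_sub, sub_zero, π.valueMap_circProj, π.valueMap_apply, apcm_vec hA,
      (isCritical_iff A π).1 hπ]
    exact (mul_pos hpos π.length_pos).ne'

/-- A critical cycle is determined by its face, since off the edges of the cycle the face of the
cube is not constrained. -/
theorem next_eq_of_cycleFace_subset (hn : 1 ≤ n) (hA : A.transpose = -A)
    (hpos : 0 < lambdaMax A) (hπ : IsCritical A π) {ρ : DirectedCycle n} (hρ : IsCritical A ρ)
    (h : cycleFace (dilatedZperp A) π ⊆ cycleFace (dilatedZperp A) ρ) {i : Fin n}
    (hi : i ∈ ρ.verts) : i ∈ π.verts ∧ π.next i = ρ.next i := by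
  have hmem : circProj n (faceCenter A π) ∈ cycleFace (dilatedZperp A) ρ := by
    refine h ?_
    rw [cycleFace_dilatedZperp hn hA hπ]
    exact ⟨⟨_, faceCenter_mem_cube hn hA, rfl⟩, by
      rw [π.valueMap_circProj, valueMap_faceCenter hn hA hpos hπ]⟩
  rw [cycleFace_dilatedZperp hn hA hρ] at hmem
  have h0 := hmem.2
  rw [ρ.valueMap_circProj,
    valueMap_eq_zero_iff_of_mem_cube hn hA hρ (faceCenter_mem_cube hn hA)] at h0
  have h1 := h0 i hi
  rw [apcm_faceCenter hA] at h1
  exact DirectedCycle.circMatrix_eq_one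
    (mul_left_cancel₀ hpos.ne' (by linarith))

theorem injOn_cycleFace (hn : 1 ≤ n) (hA : A.transpose = -A) (hpos : 0 < lambdaMax A) :
    Set.InjOn (cycleFace (dilatedZperp A)) {π | IsCritical A π} := by
  intro π hπ ρ hρ h
  have h1 := fun i hi => next_eq_of_cycleFace_subset hn hA hpos hπ hρ h.subset (i := i) hi
  have h2 := fun i hi => next_eq_of_cycleFace_subset hn hA hpos hρ hπ h.symm.subset (i := i) hi
  have hverts : π.verts = ρ.verts :=
    Finset.Subset.antisymm (fun i hi => (h2 i hi).1) fun i hi => (h1 i hi).1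
  refine DirectedCycle.ext hverts (Equiv.ext fun i => ?_)
  by_cases hi : i ∈ ρ.verts
  · exact (h1 i hi).2
  · rw [ρ.next_of_notMem i hi, π.next_of_notMem i (hverts ▸ hi)]

end Critical

/-- If a circulation is nonnegative on the dilated zonotope, then at every point of the cube where
it vanishes the positive edges of the circulation are at their lower bound. -/
theorem eq_sub_lambdaMax_of_inner_eq_zero (hn : 1 ≤ n) {A : Matrix (Fin n) (Fin n) ℝ}
    (hA : A.transpose = -A) {c : APCMSpace n}
    (hc : ∀ x ∈ cube (vec A) (lambdaMax A), 0 ≤ inner ℝ c x) {x : APCMSpace n}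
    (hx : x ∈ cube (vec A) (lambdaMax A)) (hx0 : inner ℝ c x = 0) {i j : Fin n}
    (hij : 0 < apcm c i j) : apcm x i j = A i j - lambdaMax A := by
  have h0 := lambdaMax_nonneg hn hA
  -- the vertex of the cube that minimizes the circulation
  let M : Matrix (Fin n) (Fin n) ℝ :=
    Matrix.of fun i j => ((SignType.sign (apcm c i j) : SignType) : ℝ)
  have hM : ∀ i j, M j i = -M i j := fun i j => by
    simp only [M, Matrix.of_apply]
    rw [apcm_swap c i j, Left.sign_neg, SignType.coe_neg]
  let v : APCMSpace n := vec A - lambdaMax A • vec M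
  have hv : ∀ i j, apcm v i j = A i j - lambdaMax A * M i j := fun i j => by
    simp only [v]
    rw [map_sub, map_smul, apcm_vec hA, apcm_vec_of_swap hM]
    rfl
  have hvc : v ∈ cube (vec A) (lambdaMax A) := by
    rw [mem_cube_iff h0]
    intro i j
    rw [hv, apcm_vec hA, sub_sub_cancel_left, abs_neg, abs_mul, abs_of_nonneg h0]
    exact mul_le_of_le_one_right h0 (abs_coe_sign_le_one _)
  have hterm : ∀ i j, 0 ≤ apcm c i j * apcm (x - v) i j := by
    intro i j
    have h1 := (mem_cube_iff h0).1 hx i j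
    rw [apcm_vec hA, abs_le] at h1
    have h2 : apcm (x - v) i j = apcm x i j - A i j + lambdaMax A * M i j := by
      rw [map_sub, Matrix.sub_apply, hv]; ring
    rw [h2]
    simp only [M, Matrix.of_apply]
    rcases lt_trichotomy (apcm c i j) 0 with h | h | h
    · rw [sign_neg h]
      simp only [SignType.coe_neg, SignType.coe_one]
      nlinarith
    · rw [h, zero_mul]
    · rw [sign_pos h]
      simp only [SignType.coe_one]
      nlinarith
  have hsum := sum_sum_apcm_mul_apcm c (x - v)
  rw [inner_sub_right, hx0] at hsum
  have hsum0 : ∑ i, ∑ j, apcm c i j * apcm (x - v) i j = 0 :=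
    le_antisymm (by linarith [hc v hvc])
      (Finset.sum_nonneg fun i _ => Finset.sum_nonneg fun j _ => hterm i j)
  have h1 := (Finset.sum_eq_zero_iff_of_nonneg fun i _ =>
    Finset.sum_nonneg fun j _ => hterm i j).1 hsum0 i (Finset.mem_univ i)
  have h2 := (Finset.sum_eq_zero_iff_of_nonneg fun j _ => hterm i j).1 h1 j (Finset.mem_univ j)
  have h3 := (mul_eq_zero.1 h2).resolve_left hij.ne'
  rw [map_sub, Matrix.sub_apply, hv] at h3
  simp only [M, Matrix.of_apply, sign_pos hij, SignType.coe_one] at h3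
  linarith

/-- A nonzero circulation is positive along some cycle. -/
theorem exists_directedCycle_of_circulation {c : APCMSpace n} (hc : c ∈ (ST n)ᗮ) (hc0 : c ≠ 0) :
    ∃ π : DirectedCycle n, ∀ i ∈ π.verts, 0 < apcm c i (π.next i) := by
  have hrow := mem_ST_orthogonal_iff.1 hc
  let S : Set (Fin n) := {i | ∃ j, 0 < apcm c i j}
  have hout : ∀ i j, 0 < apcm c i j → j ∈ S := by
    intro i j hij
    have h1 : ∃ k ∈ Finset.univ, apcm c j k < 0 :=
      ⟨i, Finset.mem_univ i, by rw [apcm_swap c i j]; linarith⟩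
    by_contra hS
    have h2 : ∀ k, apcm c j k ≤ 0 := fun k => not_lt.1 fun h => hS ⟨k, h⟩
    have := Finset.sum_lt_sum (fun k _ => h2 k) h1
    rw [hrow j] at this
    simp at this
  have hS : S.Nonempty := by
    by_contra hS
    refine hc0 (apcm_injective ?_)
    rw [map_zero]
    have h : ∀ i j, apcm c i j ≤ 0 := fun i j => not_lt.1 fun h => hS ⟨i, j, h⟩
    ext i j
    have h1 := h j i
    rw [apcm_swap c i j] at h1
    exact le_antisymm (h i j) (show 0 ≤ apcm c i j by linarith)
  obtain ⟨π, hπ⟩ := exists_directedCycle (R := fun i j => 0 < apcm c i j) hS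
    fun i ⟨j, hij⟩ => ⟨j, hout i j hij, hij⟩
  exact ⟨π, fun i hi => (hπ i hi).2⟩

/-- A functional exposing a facet through the origin is a circulation; any cycle in its positive
support is critical, and its face contains the facet, hence coincides with it. -/
theorem exists_isCritical_cycleFace_eq (hn : 1 ≤ n) {A : Matrix (Fin n) (Fin n) ℝ}
    (hA : A.transpose = -A) (hpos : 0 < lambdaMax A) {F : Set (APCMSpace n)}
    (hF : IsFacet (dilatedZperp A) F) (h0F : 0 ∈ F) :
    ∃ π, IsCritical A π ∧ cycleFace (dilatedZperp A) π = F := by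
  obtain ⟨hne, hexp, hdim⟩ := hF
  obtain ⟨l, hl⟩ := hexp hne
  have h0Q := zero_mem_dilatedZperp hn hA
  have hlle : ∀ y ∈ dilatedZperp A, l y ≤ 0 := by
    rw [hl] at h0F
    simpa using h0F.2
  have hFl : F = {y ∈ dilatedZperp A | l y = 0} := by
    rw [hl]
    ext y
    constructor
    · rintro ⟨hy, hmax⟩
      exact ⟨hy, le_antisymm (hlle y hy) (by simpa using hmax 0 h0Q)⟩
    · rintro ⟨hy, hy0⟩
      exact ⟨hy, fun z hz => hy0 ▸ hlle z hz⟩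
  let c : APCMSpace n := -circProj n ((InnerProductSpace.toDual ℝ (APCMSpace n)).symm l)
  have hcmem : c ∈ (ST n)ᗮ := Submodule.neg_mem _ (circProj_mem _)
  have hcl : ∀ x, inner ℝ c x = -l (circProj n x) := by
    intro x
    rw [← InnerProductSpace.toDual_symm_apply (𝕜 := ℝ) (x := circProj n x) (y := l),
      ← inner_circProj_right hcmem, inner_neg_left, real_inner_comm,
      inner_circProj_right (circProj_mem x), real_inner_comm]
  have hc0 : c ≠ 0 := by
    intro h
    have hFQ : F = dilatedZperp A := by
      rw [hFl]
      refine Set.Subset.antisymm (fun y hy => hy.1) ?_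
      rintro _ ⟨x, hx, rfl⟩
      refine ⟨⟨x, hx, rfl⟩, ?_⟩
      have := hcl x
      rw [h, inner_zero_left] at this
      linarith
    rw [hFQ] at hdim
    omega
  have hcnonneg : ∀ x ∈ cube (vec A) (lambdaMax A), 0 ≤ inner ℝ c x := fun x hx => by
    rw [hcl]
    linarith [hlle _ ⟨x, hx, rfl⟩]
  obtain ⟨π, hπc⟩ := exists_directedCycle_of_circulation hcmem hc0
  have htight : ∀ x ∈ cube (vec A) (lambdaMax A), l (circProj n x) = 0 →
      π.valueMap x = π.value A - lambdaMax A * π.length := by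
    intro x hx hx0
    have h : ∀ i ∈ π.verts, apcm x i (π.next i) = A i (π.next i) - lambdaMax A := fun i hi =>
      eq_sub_lambdaMax_of_inner_eq_zero hn hA hcnonneg hx (by rw [hcl, hx0, neg_zero]) (hπc i hi)
    rw [π.valueMap_apply, DirectedCycle.value, Finset.sum_congr rfl h, Finset.sum_sub_distrib,
      Finset.sum_const, nsmul_eq_mul, mul_comm]
    rfl
  have hcrit : IsCritical A π := by
    obtain ⟨x, hx, hx0⟩ := h0Q
    have h := htight x hx (by rw [hx0, map_zero])
    rw [← π.valueMap_circProj, hx0, map_zero] at h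
    rw [isCritical_iff]
    linarith
  refine ⟨π, hcrit, ?_⟩
  have hsub : F ⊆ cycleFace (dilatedZperp A) π := by
    rw [cycleFace_dilatedZperp hn hA hcrit, hFl]
    rintro _ ⟨⟨x, hx, rfl⟩, hx0⟩
    refine ⟨⟨x, hx, rfl⟩, ?_⟩
    rw [π.valueMap_circProj, htight x hx hx0, (isCritical_iff A π).1 hcrit, sub_self]
  have hspan : vectorSpan ℝ F = vectorSpan ℝ (cycleFace (dilatedZperp A) π) := by
    refine Submodule.eq_of_le_of_finrank_eq (vectorSpan_mono ℝ hsub) ?_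
    have := (isFacet_cycleFace hn hA hpos hcrit).1.2.2
    omega
  refine Set.Subset.antisymm (fun y hy => ?_) hsub
  -- both faces span the same directions, and the exposing functional vanishes on those of `F`
  have hker : vectorSpan ℝ F ≤ LinearMap.ker (l : APCMSpace n →ₗ[ℝ] ℝ) := by
    rw [vectorSpan_def, Submodule.span_le]
    rintro _ ⟨u, hu, z, hz, rfl⟩
    rw [hFl] at hu hz
    simp [hu.2, hz.2]
  have hy' : y -ᵥ 0 ∈ vectorSpan ℝ F := by
    rw [hspan]
    exact vsub_mem_vectorSpan ℝ hy (hsub h0F)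
  rw [hFl]
  exact ⟨hy.1, by simpa using hker hy'⟩

theorem bijOn_cycleFace (hn : 1 ≤ n) {A : Matrix (Fin n) (Fin n) ℝ} (hA : A.transpose = -A)
    (hpos : 0 < lambdaMax A) :
    Set.BijOn (cycleFace (dilatedZperp A)) {π | IsCritical A π}
      {F | IsFacet (dilatedZperp A) F ∧ (0 : APCMSpace n) ∈ F} :=
  ⟨fun _ hπ => isFacet_cycleFace hn hA hpos hπ, injOn_cycleFace hn hA hpos,
    fun _ hF => exists_isCritical_cycleFace_eq hn hA hpos hF.1 hF.2⟩

end PairwiseRanking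

theorem mainTheorem5 (n : ℕ) (hn : 1 ≤ n) (A : Matrix (Fin n) (Fin n) ℝ)
    (hA : A.transpose = -A) :
    -- the projection of a cube onto `ST` is a permutahedron centered at `h(A)`;
    -- the unit cube is the case `r = 1 / 2`, with scaling factor `1 / n`
    (∀ r : ℝ, 0 < r →
      (PairwiseRanking.ST n).starProjection '' PairwiseRanking.cube (PairwiseRanking.vec A) r =
        (fun w => PairwiseRanking.vec (PairwiseRanking.scoreMatrix w)) ''
          PairwiseRanking.scaledPermutahedron (2 * r / n) (PairwiseRanking.hodgeRank A)) ∧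
    -- `Z_⊥` is a polytope, a zonotope, symmetric about `A - P(A)`
    PairwiseRanking.IsPolytope (PairwiseRanking.Zperp A) ∧
    PairwiseRanking.IsZonotope (PairwiseRanking.residual A) (PairwiseRanking.Zperp A) ∧
    Equiv.pointReflection (PairwiseRanking.residual A) '' PairwiseRanking.Zperp A =
      PairwiseRanking.Zperp A ∧
    -- `λ_max(A)` is the unique tropical eigenvalue of `A`
    (∀ μ : ℝ, (∃ m : Fin n → ℝ, PairwiseRanking.IsTropicalEigenpair A μ m) ↔
      μ = PairwiseRanking.lambdaMax A) ∧
    -- the distance from the centre of `Z_⊥` to `0`, in the norm whose unit ball is the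
    -- translate of `Z_⊥` centered at the origin
    gauge ((fun z => z - PairwiseRanking.residual A) '' PairwiseRanking.Zperp A)
      (0 - PairwiseRanking.residual A) = PairwiseRanking.lambdaMax A ∧
    -- critical cycles are the facets through `0` of the dilate of `Z_⊥` about its centre
    (PairwiseRanking.vec A ∉ PairwiseRanking.ST n →
      Set.BijOn
        (PairwiseRanking.cycleFace
          (AffineMap.homothety (PairwiseRanking.residual A) (PairwiseRanking.lambdaMax A) ''
            PairwiseRanking.Zperp A))
        {π | PairwiseRanking.IsCritical A π}
        {F | PairwiseRanking.IsFacet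
            (AffineMap.homothety (PairwiseRanking.residual A) (PairwiseRanking.lambdaMax A) ''
              PairwiseRanking.Zperp A) F ∧
          (0 : PairwiseRanking.APCMSpace n) ∈ F}) := by
  refine ⟨fun r hr => PairwiseRanking.starProjection_ST_image_cube hA hr.le,
    PairwiseRanking.isPolytope_Zperp A, PairwiseRanking.isZonotope_Zperp A,
    PairwiseRanking.pointReflection_image_Zperp A,
    PairwiseRanking.exists_isTropicalEigenpair_iff hn A, PairwiseRanking.gauge_Zperp hn hA,
    fun hST => ?_⟩
  have hpos := PairwiseRanking.lambdaMax_pos hn hA hST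
  rw [PairwiseRanking.homothety_image_Zperp A hpos]
  exact PairwiseRanking.bijOn_cycleFace hn hA hpos
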